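/- Let $(\Omega,\mathscr F,\mathbf P)$ be a probability space with a filtration $(\mathscr F_t)_{t\ge 0}$, let $A,C\in\mathbb R^{n\times n}$, $b,\gamma\in\mathbb R^{n\times m}$, $G=G^\top\in\mathbb R^{n\times n}$, $\Gamma=\Gamma^\top\in\mathbb R^{m\times m}$. Let $(\xi_t)_{t\ge 0}$ be real white noise adapted to $(\mathscr F_t)$, i.e. mutually independent random variables with $\mathbf E\,\xi_t=0$ and $\mathrm{Var}(\xi_t)=1$, and let $a$ be an $\mathscr F_0$-measurable random vector in $\mathbb R^n$, independent of $(\xi_t)_{t\ge0}$, with $\mathbf E|a|^2<\infty$. For a deterministic control $u\in\mathbf U=\{(u_t)_{t\ge0}:\ u_t\in\mathbb R^m,\ \sum_{t\ge 0}|u_t|^2<\infty\}$ let $$x_{t+1}=Ax_t+bu_t+Cx_t\,\xi_{t+1}\quad(t\ge 0),\qquad x_0=a,$$ $$\Phi(u)=\sum_{t=0}^{\infty}\mathbf E\left[x_t^\top Gx_t+2x_t^\top\gamma u_t+u_t^\top\Gamma u_t\right].$$ Assume that $\rho(A)<1$ and that the system is mean-square stable for $u\equiv 0$: for every initial state in $\mathbb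 R^n$ the solution with $u\equiv 0$ satisfies $\mathbf E|x_t|^2\to 0$ as $t\to\infty$. Then $\Phi(u)$ is well defined for every $u\in\mathbf U$ (the expectations exist and the series converges), and there is exactly one pair of symmetric matrices $H,\Theta\in\mathbb C^{n\times n}$ with $$A^\top HA-H+\Theta=0,\qquad \Theta-C^\top HC-G=0.$$ With this $\Theta$ put, for $x\in\mathbb C^n$ and $u\in\mathbb C^m$, $$\mathcal F(x,u)=x^*\Theta x+2\,\mathrm{Re}\,x^*\gamma u+u^*\Gamma u,\qquad g(z)=(zI-A)^{-1}.$$ Suppose that there is an optimal control, i.e. some $u^o\in\mathbf U$ with $\Phi(u^o)\le\Phi(u)$ for all $u\in\mathbf U$. Then: (i) $\mathcal F(g(z)bu,u)\ge 0$ for all $z\in\mathbb C$ with $|z|=1$ and all $u\in\mathbb C^m$. (ii) If moreover there is a $\delta>0$ such that $\mathcal F(g(z)bu,u)\ge\delta|u|^2$ for all $z\in\mathbb C$ with $|z|=1$ and all $u\in\mathbb C^m$, then $u^o$ is unique: every optimal control in $\mathbf U$ equals $u^o$. -/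

import Mathlib

open MeasureTheory ProbabilityTheory Filter Topology Matrix

namespace LQ

noncomputable section

/-- The state process of `x_{t+1} = A x_t + b u_t + C x_t ξ_{t+1}`, `x_0 = a`, for a
(deterministic) control sequence `u`. -/
def state {Ω : Type*} {n m : ℕ} (A C : Matrix (Fin n) (Fin n) ℝ) (b : Matrix (Fin n) (Fin m) ℝ)
    (ξ : ℕ → Ω → ℝ) (a : Ω → Fin n → ℝ) (u : ℕ → Fin m → ℝ) : ℕ → Ω → Fin n → ℝ
  | 0 => a
  | t + 1 => fun ω =>
      A *ᵥ state A C b ξ a u t ω + b *ᵥ u t + ξ (t + 1) ω • (C *ᵥ state A C b ξ a u t ω)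

/-- The quadratic stage cost `xᵀ G x + 2 xᵀ γ u + uᵀ Γ u` of real vectors. -/
def stageCost {n m : ℕ} (G : Matrix (Fin n) (Fin n) ℝ) (γ : Matrix (Fin n) (Fin m) ℝ)
    (Γ : Matrix (Fin m) (Fin m) ℝ) (x : Fin n → ℝ) (u : Fin m → ℝ) : ℝ :=
  x ⬝ᵥ (G *ᵥ x) + 2 * (x ⬝ᵥ (γ *ᵥ u)) + u ⬝ᵥ (Γ *ᵥ u)

/-- The set of admissible controls: square-summable sequences in `ℝ^m`. -/
def admissible (m : ℕ) : Set (ℕ → Fin m → ℝ) :=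
  {u | Summable fun t => ∑ i, (u t i) ^ 2}

/-- The functional `Φ(u) = ∑_t E [x_tᵀ G x_t + 2 x_tᵀ γ u_t + u_tᵀ Γ u_t]`. -/
def cost {Ω : Type*} [MeasurableSpace Ω] (P : Measure Ω) {n m : ℕ}
    (A C : Matrix (Fin n) (Fin n) ℝ) (b : Matrix (Fin n) (Fin m) ℝ)
    (G : Matrix (Fin n) (Fin n) ℝ) (γ : Matrix (Fin n) (Fin m) ℝ) (Γ : Matrix (Fin m) (Fin m) ℝ)
    (ξ : ℕ → Ω → ℝ) (a : Ω → Fin n → ℝ) (u : ℕ → Fin m → ℝ) : ℝ :=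
  ∑' t, ∫ ω, stageCost G γ Γ (state A C b ξ a u t ω) (u t) ∂P

/-- `u` is an optimal control: it is admissible and minimizes `Φ` over the admissible controls. -/
def IsOptimal {Ω : Type*} [MeasurableSpace Ω] (P : Measure Ω) {n m : ℕ}
    (A C : Matrix (Fin n) (Fin n) ℝ) (b : Matrix (Fin n) (Fin m) ℝ)
    (G : Matrix (Fin n) (Fin n) ℝ) (γ : Matrix (Fin n) (Fin m) ℝ) (Γ : Matrix (Fin m) (Fin m) ℝ)
    (ξ : ℕ → Ω → ℝ) (a : Ω → Fin n → ℝ) (u : ℕ → Fin m → ℝ) : Prop :=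
  u ∈ admissible m ∧
    ∀ v ∈ admissible m, cost P A C b G γ Γ ξ a u ≤ cost P A C b G γ Γ ξ a v

/-- Mean-square stability of the uncontrolled system `x_{t+1} = A x_t + C x_t ξ_{t+1}`:
`E |x_t|² → 0` for every initial state in `ℝ^n`. -/
def MeanSquareStable {Ω : Type*} [MeasurableSpace Ω] (P : Measure Ω) {n : ℕ}
    (A C : Matrix (Fin n) (Fin n) ℝ) (ξ : ℕ → Ω → ℝ) : Prop :=
  ∀ x₀ : Fin n → ℝ,
    Tendsto (fun t => ∫ ω, ∑ i, (state A C (0 : Matrix (Fin n) (Fin 0) ℝ) ξ (fun _ => x₀) 0 t ω i) ^ 2 ∂P)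
      atTop (𝓝 0)

/-- A real matrix, regarded as a complex one. -/
abbrev toC {k l : ℕ} (M : Matrix (Fin k) (Fin l) ℝ) : Matrix (Fin k) (Fin l) ℂ :=
  M.map Complex.ofReal

/-- `H` and `Θ` are symmetric complex matrices with `Aᵀ H A - H + Θ = 0` and
`Θ - Cᵀ H C - G = 0`. -/
def LyapunovPair {n : ℕ} (A C G : Matrix (Fin n) (Fin n) ℝ) (H Θ : Matrix (Fin n) (Fin n) ℂ) :
    Prop :=
  H.IsSymm ∧ Θ.IsSymm ∧ (toC A)ᵀ * H * toC A - H + Θ = 0 ∧ Θ - (toC C)ᵀ * H * toC C - toC G = 0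

/-- The form `F(x, u) = x* Θ x + 2 Re x* γ u + u* Γ u` on `ℂ^n × ℂ^m`. When `Θ` and `Γ` are
Hermitian, in particular real symmetric, the first and the last term are real, and taking their
real parts changes nothing. -/
def hermForm {n m : ℕ} (Θ : Matrix (Fin n) (Fin n) ℂ) (γ : Matrix (Fin n) (Fin m) ℝ)
    (Γ : Matrix (Fin m) (Fin m) ℝ) (x : Fin n → ℂ) (u : Fin m → ℂ) : ℝ :=
  (star x ⬝ᵥ (Θ *ᵥ x)).re + 2 * (star x ⬝ᵥ (toC γ *ᵥ u)).re + (star u ⬝ᵥ (toC Γ *ᵥ u)).re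

/-- `g(z) = (z I - A)⁻¹`. -/
def resolventMatrix {n : ℕ} (A : Matrix (Fin n) (Fin n) ℝ) (z : ℂ) : Matrix (Fin n) (Fin n) ℂ :=
  (z • (1 : Matrix (Fin n) (Fin n) ℂ) - toC A)⁻¹

end

end LQ

/-!
The noise is centred with variance one and independent of the current state, so second moments obey
`E[x_{t+1}ᵀ S x_{t+1}] = E[x_tᵀ (L S) x_t] + (terms in E x_t and u_t)` with
`L S = Aᵀ S A + Cᵀ S C` (`quadMean_state_succ`), and `m_t = E x_t` follows the noise-free system.

*Stability and the Lyapunov equations.* Mean-square stability says that `xᵀ (L^t S) x → 0` for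
symmetric `S`. Hence `L` has no nonzero symmetric fixed point, which gives existence and uniqueness
for `H = L H + G`. It also makes a partial sum of `∑ L^t I` a Lyapunov function, from which
square-summable controls produce states with `∑ E|x_t|² < ∞`
(`MeanSquareStable.summable_quadMean`), so that the cost converges.

*Reduction.* By the two equations, `E[x_tᵀ H x_t] - m_tᵀ H m_t` telescopes and the cost equals a
constant plus the deterministic cost `J(u) = ∑ (m_tᵀ Θ m_t + 2 m_tᵀ γ u_t + u_tᵀ Γ u_t)`
(`MeanSquareStable.cost_eq`). Along a line of controls `J` is a quadratic polynomial with leading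
coefficient `Q(v)`, the deterministic cost of `v` from the zero state. If a minimizer exists, then
`Q ≥ 0`; and minimizers are unique if `Q` is positive away from zero.

*Frequency domain.* The control `z^t w` on a long window makes the cost per unit time tend to
`F(g(z) b w, w)`, which is therefore nonnegative (`hermForm_resolvent_nonneg`). Conversely, a strict
frequency inequality gives `Q(v) ≥ (δ/2) ∑ |v_t|²` (`trajCost_coercive`) by Parseval's identity over
the `N`-th roots of unity: the discrete transforms of a trajectory on `[0, N)` satisfy
`(z - A) ŷ = b v̂ - z y_N`, and `y_N → 0`.
-/

namespace LQ

/-! ### Bilinear and quadratic forms -/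

/-- Young's inequality for a bilinear form: the weight of the first argument can be made as small
as desired. -/
lemma exists_norm_bilin_le {𝕜 : Type*} [RCLike 𝕜] {k l : ℕ} (K : Matrix (Fin k) (Fin l) 𝕜) {ε : ℝ}
    (hε : 0 < ε) :
    ∃ c : ℝ, 0 ≤ c ∧ ∀ (x : Fin k → 𝕜) (u : Fin l → 𝕜),
      ‖star x ⬝ᵥ (K *ᵥ u)‖ ≤ ε * ∑ i, ‖x i‖ ^ 2 + c * ∑ j, ‖u j‖ ^ 2 := by
  set η : ℝ := ε / (l + 1) with hη
  have hη0 : 0 < η := by positivity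
  refine ⟨∑ i, ∑ j, ‖K i j‖ ^ 2 / (4 * η), by positivity, fun x u => ?_⟩
  have hterm : ∀ i j, ‖x i‖ * (‖K i j‖ * ‖u j‖) ≤
      η * ‖x i‖ ^ 2 + ‖K i j‖ ^ 2 / (4 * η) * ‖u j‖ ^ 2 := by
    intro i j
    have h : η * ‖x i‖ ^ 2 + ‖K i j‖ ^ 2 / (4 * η) * ‖u j‖ ^ 2 - ‖x i‖ * (‖K i j‖ * ‖u j‖)
        = (2 * η * ‖x i‖ - ‖K i j‖ * ‖u j‖) ^ 2 / (4 * η) := by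
      field_simp
      ring
    have h2 : 0 ≤ (2 * η * ‖x i‖ - ‖K i j‖ * ‖u j‖) ^ 2 / (4 * η) := by positivity
    linarith
  calc ‖star x ⬝ᵥ (K *ᵥ u)‖ ≤ ∑ i, ∑ j, ‖x i‖ * (‖K i j‖ * ‖u j‖) := by
        simp only [dotProduct, mulVec, Finset.mul_sum]
        refine (norm_sum_le _ _).trans (Finset.sum_le_sum fun i _ => ?_)
        refine (norm_sum_le _ _).trans (Finset.sum_le_sum fun j _ => ?_)
        simp
    _ ≤ ∑ i, ∑ j, (η * ‖x i‖ ^ 2 + ‖K i j‖ ^ 2 / (4 * η) * ‖u j‖ ^ 2) :=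
        Finset.sum_le_sum fun i _ => Finset.sum_le_sum fun j _ => hterm i j
    _ ≤ ε * ∑ i, ‖x i‖ ^ 2 + (∑ i, ∑ j, ‖K i j‖ ^ 2 / (4 * η)) * ∑ j, ‖u j‖ ^ 2 := by
        simp only [Finset.sum_add_distrib]
        refine add_le_add ?_ ?_
        · simp only [Finset.sum_const, Finset.card_univ, Fintype.card_fin, nsmul_eq_mul]
          rw [← Finset.mul_sum, ← Finset.mul_sum, ← mul_assoc]
          refine mul_le_mul_of_nonneg_right ?_ (by positivity)
          rw [hη]
          have : (l : ℝ) * (ε / (l + 1)) = ε * (l / (l + 1)) := by ring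
          rw [this]
          have h1 : (l : ℝ) / (l + 1) ≤ 1 := by
            rw [div_le_one (by positivity)]
            linarith
          nlinarith
        · rw [Finset.sum_mul]
          refine Finset.sum_le_sum fun i _ => ?_
          rw [Finset.sum_mul]
          refine Finset.sum_le_sum fun j _ => ?_
          refine mul_le_mul_of_nonneg_left ?_ (by positivity)
          exact Finset.single_le_sum (f := fun j => ‖u j‖ ^ 2) (fun _ _ => by positivity)
            (Finset.mem_univ j)

lemma sum_norm_mulVec_sq_le {k l : ℕ} (M : Matrix (Fin k) (Fin l) ℂ) (w : Fin l → ℂ) :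
    ∑ i, ‖(M *ᵥ w) i‖ ^ 2 ≤ (∑ i, ∑ j, ‖M i j‖ ^ 2) * ∑ j, ‖w j‖ ^ 2 := by
  rw [Finset.sum_mul]
  refine Finset.sum_le_sum fun i _ => ?_
  calc ‖(M *ᵥ w) i‖ ^ 2 ≤ (∑ j, ‖M i j‖ * ‖w j‖) ^ 2 := by
        refine pow_le_pow_left₀ (norm_nonneg _) ?_ 2
        simp only [mulVec, dotProduct]
        refine (norm_sum_le _ _).trans (Finset.sum_le_sum fun j _ => ?_)
        simp
    _ ≤ _ := Finset.sum_mul_sq_le_sq_mul_sq _ _ _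

lemma dotProduct_self_eq_sum_norm {k : ℕ} (x : Fin k → ℝ) : ∑ i, ‖x i‖ ^ 2 = x ⬝ᵥ x := by
  simp [dotProduct, sq]

lemma dotProduct_self_nonneg_real {k : ℕ} (x : Fin k → ℝ) : 0 ≤ x ⬝ᵥ x := by
  rw [← dotProduct_self_eq_sum_norm]
  positivity

lemma exists_abs_bilin_le {k l : ℕ} (K : Matrix (Fin k) (Fin l) ℝ) {ε : ℝ} (hε : 0 < ε) :
    ∃ c : ℝ, 0 ≤ c ∧ ∀ (x : Fin k → ℝ) (u : Fin l → ℝ),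
      |x ⬝ᵥ (K *ᵥ u)| ≤ ε * (x ⬝ᵥ x) + c * (u ⬝ᵥ u) := by
  obtain ⟨c, hc, h⟩ := exists_norm_bilin_le K hε
  refine ⟨c, hc, fun x u => ?_⟩
  rw [← dotProduct_self_eq_sum_norm, ← dotProduct_self_eq_sum_norm]
  exact h x u

lemma exists_abs_quad_le {k : ℕ} (S : Matrix (Fin k) (Fin k) ℝ) :
    ∃ c : ℝ, 0 ≤ c ∧ ∀ x : Fin k → ℝ, |x ⬝ᵥ (S *ᵥ x)| ≤ c * (x ⬝ᵥ x) := by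
  obtain ⟨c, hc, h⟩ := exists_abs_bilin_le S one_pos
  refine ⟨1 + c, by positivity, fun x => (h x x).trans_eq (by ring)⟩

lemma mulVec_bilin_mulVec {R : Type*} [CommRing R] {k l k' l' : ℕ} (A : Matrix (Fin k) (Fin k') R)
    (S : Matrix (Fin k) (Fin l) R) (B : Matrix (Fin l) (Fin l') R) (x : Fin k' → R)
    (y : Fin l' → R) :
    (A *ᵥ x) ⬝ᵥ (S *ᵥ (B *ᵥ y)) = x ⬝ᵥ ((Aᵀ * S * B) *ᵥ y) := by
  rw [← mulVec_mulVec, ← mulVec_mulVec, dotProduct_mulVec x, vecMul_transpose]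

lemma bilin_comm {R : Type*} [CommRing R] {k : ℕ} {S : Matrix (Fin k) (Fin k) R} (hS : S.IsSymm)
    (x y : Fin k → R) : x ⬝ᵥ (S *ᵥ y) = y ⬝ᵥ (S *ᵥ x) := by
  rw [dotProduct_mulVec, ← mulVec_transpose, hS.eq, dotProduct_comm]

/-- A symmetric matrix is determined by its quadratic form. -/
lemma symm_apply_eq_quad {k : ℕ} {S : Matrix (Fin k) (Fin k) ℝ} (hS : S.IsSymm) (i j : Fin k) :
    S i j = (((Pi.single i 1 + Pi.single j 1 : Fin k → ℝ) ⬝ᵥ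
        (S *ᵥ (Pi.single i 1 + Pi.single j 1)))
      - (Pi.single i 1 : Fin k → ℝ) ⬝ᵥ (S *ᵥ Pi.single i 1)
      - (Pi.single j 1 : Fin k → ℝ) ⬝ᵥ (S *ᵥ Pi.single j 1)) / 2 := by
  have h := bilin_comm hS (Pi.single i 1) (Pi.single j 1)
  have h2 : (Pi.single i 1 : Fin k → ℝ) ⬝ᵥ (S *ᵥ Pi.single j 1) = S i j := by simp
  simp only [mulVec_add, dotProduct_add, add_dotProduct]
  rw [← h, h2]
  ring

/-- The operator `S ↦ Aᵀ S A + Cᵀ S C`, which governs the second moments of the uncontrolled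
system. -/
def lyap {n : ℕ} (A C : Matrix (Fin n) (Fin n) ℝ) :
    Matrix (Fin n) (Fin n) ℝ →ₗ[ℝ] Matrix (Fin n) (Fin n) ℝ where
  toFun S := Aᵀ * S * A + Cᵀ * S * C
  map_add' S T := by
    simp only [mul_add, add_mul]
    abel
  map_smul' r S := by simp

lemma lyap_apply {n : ℕ} (A C S : Matrix (Fin n) (Fin n) ℝ) :
    lyap A C S = Aᵀ * S * A + Cᵀ * S * C := rfl

lemma lyap_isSymm {n : ℕ} (A C : Matrix (Fin n) (Fin n) ℝ) {S : Matrix (Fin n) (Fin n) ℝ}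
    (hS : S.IsSymm) : (lyap A C S).IsSymm := by
  simp only [IsSymm, lyap_apply, transpose_add, transpose_mul, transpose_transpose, hS.eq,
    Matrix.mul_assoc]

lemma lyap_pow_isSymm {n : ℕ} (A C : Matrix (Fin n) (Fin n) ℝ) {S : Matrix (Fin n) (Fin n) ℝ}
    (hS : S.IsSymm) (t : ℕ) : ((lyap A C ^ t) S).IsSymm := by
  induction t with
  | zero => simpa using hS
  | succ t ih =>
    rw [pow_succ', Module.End.mul_apply]
    exact lyap_isSymm A C ih

lemma quad_lyap {n : ℕ} (A C S : Matrix (Fin n) (Fin n) ℝ) (x : Fin n → ℝ) :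
    x ⬝ᵥ (lyap A C S *ᵥ x) =
      (A *ᵥ x) ⬝ᵥ (S *ᵥ (A *ᵥ x)) + (C *ᵥ x) ⬝ᵥ (S *ᵥ (C *ᵥ x)) := by
  rw [lyap_apply, add_mulVec, dotProduct_add, mulVec_bilin_mulVec, mulVec_bilin_mulVec]

lemma quad_lyap_pow_nonneg {n : ℕ} (A C : Matrix (Fin n) (Fin n) ℝ)
    {S : Matrix (Fin n) (Fin n) ℝ} (hS : ∀ x, 0 ≤ x ⬝ᵥ (S *ᵥ x)) (t : ℕ) (x : Fin n → ℝ) :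
    0 ≤ x ⬝ᵥ ((lyap A C ^ t) S *ᵥ x) := by
  induction t generalizing x with
  | zero => simpa using hS x
  | succ t ih =>
    rw [pow_succ', Module.End.mul_apply, quad_lyap]
    exact add_nonneg (ih _) (ih _)

/-! ### Moments of the state process -/

/-- Real white noise: independent centred random variables of variance one. -/
structure IsWhiteNoise {Ω : Type*} [MeasurableSpace Ω] (P : Measure Ω) (ξ : ℕ → Ω → ℝ) : Prop where
  meas : ∀ t, Measurable (ξ t)
  indep : iIndepFun ξ P
  mean : ∀ t, ∫ ω, ξ t ω ∂P = 0
  var : ∀ t, variance (ξ t) P = 1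

/-- A square-integrable random initial state that is independent of the noise. -/
structure IsInitialState {Ω : Type*} [MeasurableSpace Ω] (P : Measure Ω) (ξ : ℕ → Ω → ℝ) {n : ℕ}
    (a : Ω → Fin n → ℝ) : Prop where
  meas : Measurable a
  indep : IndepFun a (fun ω t => ξ t ω) P
  memLp : ∀ i, MemLp (fun ω => a ω i) 2 P

/-- The mean of a random vector. -/
noncomputable def mean {Ω : Type*} [MeasurableSpace Ω] (P : Measure Ω) {n : ℕ}
    (x : Ω → Fin n → ℝ) : Fin n → ℝ :=
  fun i => ∫ ω, x ω i ∂P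

/-- The expectation `E[xᵀ S x]`. -/
noncomputable def quadMean {Ω : Type*} [MeasurableSpace Ω] (P : Measure Ω) {n : ℕ}
    (x : Ω → Fin n → ℝ) (S : Matrix (Fin n) (Fin n) ℝ) : ℝ :=
  ∫ ω, x ω ⬝ᵥ (S *ᵥ x ω) ∂P

section

variable {Ω : Type*} [MeasurableSpace Ω] {P : Measure Ω} {n m : ℕ}
  {A C : Matrix (Fin n) (Fin n) ℝ} {b : Matrix (Fin n) (Fin m) ℝ}
  {ξ : ℕ → Ω → ℝ} {a : Ω → Fin n → ℝ} {u : ℕ → Fin m → ℝ}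

lemma isInitialState_const [IsProbabilityMeasure P] (x₀ : Fin n → ℝ) :
    IsInitialState P ξ (fun _ => x₀) :=
  ⟨measurable_const, indepFun_const_left _ _, fun _ => memLp_const _⟩

lemma measurable_mulVec {k : ℕ} (M : Matrix (Fin k) (Fin n) ℝ) :
    Measurable fun x : Fin n → ℝ => M *ᵥ x := by
  have : Continuous fun x : Fin n → ℝ => M *ᵥ x := by fun_prop
  exact this.measurable

/-- `x_t` is a measurable function of `a` and `ξ_1, …, ξ_t`. The σ-algebra is arbitrary, so that
the lemma applies to the one generated by these variables. -/
lemma measurable_state {Ω : Type*} {m' : MeasurableSpace Ω} {ξ : ℕ → Ω → ℝ} {a : Ω → Fin n → ℝ}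
    (t : ℕ) (ha : Measurable a)
    (hξ : ∀ s ≤ t, Measurable (ξ s)) : Measurable (state A C b ξ a u t) := by
  induction t with
  | zero => exact ha
  | succ t ih =>
    have h := ih fun s hs => hξ s (hs.trans t.le_succ)
    have h1 := (measurable_mulVec A).comp h
    have h2 := (measurable_mulVec C).comp h
    exact (h1.add_const (b *ᵥ u t)).add ((hξ _ le_rfl).smul h2)

lemma IndepFun.prodMk_left_of_prodMk_right {β₁ β₂ β₃ : Type*} [MeasurableSpace β₁]
    [MeasurableSpace β₂] [MeasurableSpace β₃] [IsProbabilityMeasure P] {X : Ω → β₁} {Y : Ω → β₂}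
    {Z : Ω → β₃} (hX : Measurable X) (hY : Measurable Y) (hZ : Measurable Z)
    (h : IndepFun X (fun ω => (Y ω, Z ω)) P) (hYZ : IndepFun Y Z P) :
    IndepFun (fun ω => (X ω, Y ω)) Z P := by
  have hXY : IndepFun X Y P := h.comp (φ := id) (ψ := Prod.fst) measurable_id measurable_fst
  have := Measure.isProbabilityMeasure_map (μ := P) hX.aemeasurable
  have := Measure.isProbabilityMeasure_map (μ := P) hY.aemeasurable
  have := Measure.isProbabilityMeasure_map (μ := P) hZ.aemeasurable
  rw [indepFun_iff_map_prod_eq_prod_map_map hX.aemeasurable (hY.prodMk hZ).aemeasurable] at h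
  rw [indepFun_iff_map_prod_eq_prod_map_map hX.aemeasurable hY.aemeasurable] at hXY
  rw [indepFun_iff_map_prod_eq_prod_map_map hY.aemeasurable hZ.aemeasurable] at hYZ
  rw [indepFun_iff_map_prod_eq_prod_map_map (hX.prodMk hY).aemeasurable hZ.aemeasurable, hXY]
  rw [hYZ, ← Measure.prodAssoc_prod] at h
  refine MeasurableEquiv.prodAssoc.map_measurableEquiv_injective ?_
  rw [← h, Measure.map_map MeasurableEquiv.prodAssoc.measurable ((hX.prodMk hY).prodMk hZ)]
  rfl

lemma indepFun_state [IsProbabilityMeasure P] (hξ : IsWhiteNoise P ξ) (ha : IsInitialState P ξ a)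
    (t : ℕ) : IndepFun (state A C b ξ a u t) (ξ (t + 1)) P := by
  set Y : Ω → (Finset.range (t + 1) → ℝ) := fun ω i => ξ i ω with hYdef
  have hY : Measurable Y := measurable_pi_lambda _ fun i => hξ.meas i
  have hYZ : IndepFun Y (ξ (t + 1)) P :=
    (hξ.indep.indepFun_finset (Finset.range (t + 1)) {t + 1} (by simp) hξ.meas).comp
      (φ := id) (ψ := fun z : ({t + 1} : Finset ℕ) → ℝ => z ⟨t + 1, by simp⟩) measurable_id
      (measurable_pi_apply _)
  have h : IndepFun a (fun ω => (Y ω, ξ (t + 1) ω)) P :=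
    ha.indep.comp (φ := id) (ψ := fun z : ℕ → ℝ =>
      ((fun i => z i, z (t + 1)) : (Finset.range (t + 1) → ℝ) × ℝ)) measurable_id (by fun_prop)
  have key := IndepFun.prodMk_left_of_prodMk_right ha.meas hY (hξ.meas _) h hYZ
  refine indep_of_indep_of_le_left key ?_
  rw [← measurable_iff_comap_le]
  have hpair := comap_measurable (m := inferInstance) (fun ω => (a ω, Y ω))
  refine measurable_state (m' := MeasurableSpace.comap _ _) t (measurable_fst.comp hpair)
    fun s hs => ?_
  exact (measurable_pi_apply (⟨s, by simp; omega⟩ : Finset.range (t + 1))).comp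
    (measurable_snd.comp hpair)

/-- Variance one is not the junk value of an infinite variance, so the noise is
square-integrable. -/
lemma IsWhiteNoise.memLp [IsProbabilityMeasure P] (hξ : IsWhiteNoise P ξ) (t : ℕ) :
    MemLp (ξ t) 2 P := by
  rw [← evariance_lt_top_iff_memLp (hξ.meas t).aestronglyMeasurable, lt_top_iff_ne_top]
  intro h
  have := hξ.var t
  simp [variance, h] at this

lemma IsWhiteNoise.integral_sq [IsProbabilityMeasure P] (hξ : IsWhiteNoise P ξ) (t : ℕ) :
    ∫ ω, ξ t ω ^ 2 ∂P = 1 := by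
  have h := variance_eq_sub (hξ.memLp t)
  rw [hξ.var, hξ.mean] at h
  simpa using h.symm

lemma memLp_mulVec {k : ℕ} {x : Ω → Fin n → ℝ} (hx : ∀ i, MemLp (fun ω => x ω i) 2 P)
    (M : Matrix (Fin k) (Fin n) ℝ) (i : Fin k) : MemLp (fun ω => (M *ᵥ x ω) i) 2 P :=
  memLp_finsetSum (Finset.univ) (f := fun j ω => M i j * x ω j) fun j _ =>
    (hx j).const_mul (M i j)

lemma memLp_state [IsProbabilityMeasure P] (hξ : IsWhiteNoise P ξ) (ha : IsInitialState P ξ a)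
    (t : ℕ) (i : Fin n) : MemLp (fun ω => state A C b ξ a u t ω i) 2 P := by
  induction t generalizing i with
  | zero => exact ha.memLp i
  | succ t ih =>
    have h1 := memLp_mulVec ih A i
    have h2 := memLp_mulVec ih C i
    have hmeas : Measurable fun x : Fin n → ℝ => (C *ᵥ x) i ^ 2 :=
      ((measurable_pi_apply i).comp (measurable_mulVec C)).pow_const 2
    have hind := (indepFun_state (A := A) (C := C) (b := b) (u := u) hξ ha t).symm.comp
      (measurable_id.pow_const 2) hmeas
    have h3 : MemLp (fun ω => ξ (t + 1) ω * (C *ᵥ state A C b ξ a u t ω) i) 2 P := by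
      rw [memLp_two_iff_integrable_sq
        (by exact (hξ.meas _).aestronglyMeasurable.mul h2.aestronglyMeasurable)]
      have := hind.integrable_mul (hξ.memLp (t + 1)).integrable_sq h2.integrable_sq
      simp only [mul_pow]
      exact this
    exact (h1.add (memLp_const ((b *ᵥ u t) i))).add h3

lemma integrable_bilin {k l : ℕ} {x : Ω → Fin k → ℝ} {y : Ω → Fin l → ℝ}
    (hx : ∀ i, MemLp (fun ω => x ω i) 2 P) (hy : ∀ i, MemLp (fun ω => y ω i) 2 P)
    (S : Matrix (Fin k) (Fin l) ℝ) : Integrable (fun ω => x ω ⬝ᵥ (S *ᵥ y ω)) P :=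
  integrable_finsetSum _ fun i _ => (hx i).integrable_mul (memLp_mulVec hy S i)

lemma integral_dotProduct_const [IsProbabilityMeasure P] {x : Ω → Fin n → ℝ}
    (hx : ∀ i, MemLp (fun ω => x ω i) 2 P) (w : Fin n → ℝ) :
    ∫ ω, x ω ⬝ᵥ w ∂P = mean P x ⬝ᵥ w := by
  simp only [dotProduct, mean]
  rw [integral_finsetSum _ fun i _ => ((hx i).integrable one_le_two).mul_const (w i)]
  simp only [integral_mul_const]

lemma integrable_dotProduct_const [IsProbabilityMeasure P] {x : Ω → Fin n → ℝ}
    (hx : ∀ i, MemLp (fun ω => x ω i) 2 P) (w : Fin n → ℝ) :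
    Integrable (fun ω => x ω ⬝ᵥ w) P :=
  integrable_finsetSum _ fun i _ => ((hx i).integrable one_le_two).mul_const (w i)

lemma mean_state_succ [IsProbabilityMeasure P] (hξ : IsWhiteNoise P ξ)
    (ha : IsInitialState P ξ a) (t : ℕ) :
    mean P (state A C b ξ a u (t + 1)) = A *ᵥ mean P (state A C b ξ a u t) + b *ᵥ u t := by
  have hx := memLp_state (A := A) (C := C) (b := b) (u := u) hξ ha t
  have hind := indepFun_state (A := A) (C := C) (b := b) (u := u) hξ ha t
  ext i
  have hA := (memLp_mulVec hx A i).integrable one_le_two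
  have hC := memLp_mulVec hx C i
  have hindC := hind.symm.comp (φ := id) (ψ := fun x => (C *ᵥ x) i) measurable_id
    ((measurable_pi_apply i).comp (measurable_mulVec C))
  have hnoise : Integrable (fun ω => ξ (t + 1) ω * (C *ᵥ state A C b ξ a u t ω) i) P :=
    (hξ.memLp _).integrable_mul hC
  have hzero : ∫ ω, ξ (t + 1) ω * (C *ᵥ state A C b ξ a u t ω) i ∂P = 0 := by
    have := hindC.integral_fun_mul_eq_mul_integral (hξ.meas _).aestronglyMeasurable
      hC.aestronglyMeasurable
    simpa [hξ.mean] using this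
  have hmean : ∫ ω, (A *ᵥ state A C b ξ a u t ω) i ∂P
      = (A *ᵥ mean P (state A C b ξ a u t)) i := by
    have := integral_dotProduct_const hx (A i)
    simp only [mulVec]
    simp only [dotProduct_comm (A i)]
    exact this
  calc ∫ ω, ((A *ᵥ state A C b ξ a u t ω) i + (b *ᵥ u t) i
          + ξ (t + 1) ω * (C *ᵥ state A C b ξ a u t ω) i) ∂P
      = (A *ᵥ mean P (state A C b ξ a u t)) i + (b *ᵥ u t) i + 0 := by
        have hAb : Integrable (fun ω => (A *ᵥ state A C b ξ a u t ω) i + (b *ᵥ u t) i) P :=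
          hA.add (integrable_const _)
        rw [integral_add hAb hnoise, hzero,
          integral_add hA (integrable_const _), hmean]
        simp
    _ = _ := by simp

/-- The second-moment recursion: the noise enters through `Cᵀ S C` only, because it is centred
with variance one and independent of the current state. -/
lemma quadMean_state_succ [IsProbabilityMeasure P] (hξ : IsWhiteNoise P ξ)
    (ha : IsInitialState P ξ a) {S : Matrix (Fin n) (Fin n) ℝ} (hS : S.IsSymm) (t : ℕ) :
    quadMean P (state A C b ξ a u (t + 1)) S =
      quadMean P (state A C b ξ a u t) (lyap A C S)
        + 2 * (mean P (state A C b ξ a u t) ⬝ᵥ ((Aᵀ * S * b) *ᵥ u t))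
        + u t ⬝ᵥ ((bᵀ * S * b) *ᵥ u t) := by
  have hx := memLp_state (A := A) (C := C) (b := b) (u := u) hξ ha t
  have hind := indepFun_state (A := A) (C := C) (b := b) (u := u) hξ ha t
  set x := state A C b ξ a u t with hxdef
  have hp : ∀ i, MemLp (fun ω => (A *ᵥ x ω + b *ᵥ u t) i) 2 P := fun i =>
    (memLp_mulVec hx A i).add (memLp_const _)
  have hC := memLp_mulVec hx C
  have hpm : Measurable fun y : Fin n → ℝ => A *ᵥ y + b *ᵥ u t := (measurable_mulVec A).add_const _
  have hdm : ∀ f g : (Fin n → ℝ) → Fin n → ℝ, Measurable f → Measurable g →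
      Measurable fun y => f y ⬝ᵥ (S *ᵥ g y) := by
    intro f g hf hg
    have : Continuous fun q : (Fin n → ℝ) × (Fin n → ℝ) => q.1 ⬝ᵥ (S *ᵥ q.2) := by fun_prop
    exact this.measurable.comp (hf.prodMk hg)
  have hr := integrable_bilin hp hC S
  have hs := integrable_bilin hC hC S
  have hq := integrable_bilin hx hx (Aᵀ * S * A)
  have hindr := hind.symm.comp (φ := id)
    (ψ := fun y => (A *ᵥ y + b *ᵥ u t) ⬝ᵥ (S *ᵥ (C *ᵥ y))) measurable_id
    (hdm _ _ hpm (measurable_mulVec C))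
  have hinds := hind.symm.comp (φ := fun z => z ^ 2)
    (ψ := fun y => (C *ᵥ y) ⬝ᵥ (S *ᵥ (C *ᵥ y))) (measurable_id.pow_const 2)
    (hdm _ _ (measurable_mulVec C) (measurable_mulVec C))
  have hIr : Integrable (fun ω => ξ (t + 1) ω * ((A *ᵥ x ω + b *ᵥ u t) ⬝ᵥ (S *ᵥ (C *ᵥ x ω)))) P :=
    hindr.integrable_mul ((hξ.memLp _).integrable one_le_two) hr
  have hIs : Integrable (fun ω => ξ (t + 1) ω ^ 2 * ((C *ᵥ x ω) ⬝ᵥ (S *ᵥ (C *ᵥ x ω)))) P :=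
    hinds.integrable_mul (hξ.memLp _).integrable_sq hs
  have hEr : ∫ ω, ξ (t + 1) ω * ((A *ᵥ x ω + b *ᵥ u t) ⬝ᵥ (S *ᵥ (C *ᵥ x ω))) ∂P = 0 := by
    have := hindr.integral_fun_mul_eq_mul_integral (hξ.meas _).aestronglyMeasurable
      hr.aestronglyMeasurable
    simpa [hξ.mean] using this
  have hEs : ∫ ω, ξ (t + 1) ω ^ 2 * ((C *ᵥ x ω) ⬝ᵥ (S *ᵥ (C *ᵥ x ω))) ∂P
      = ∫ ω, x ω ⬝ᵥ ((Cᵀ * S * C) *ᵥ x ω) ∂P := by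
    have := hinds.integral_fun_mul_eq_mul_integral
      ((hξ.meas _).pow_const 2).aestronglyMeasurable hs.aestronglyMeasurable
    simp only [Function.comp_apply, hξ.integral_sq, one_mul] at this
    simp only [← mulVec_bilin_mulVec]
    exact this
  have hpoint : ∀ ω, state A C b ξ a u (t + 1) ω ⬝ᵥ (S *ᵥ state A C b ξ a u (t + 1) ω) =
      x ω ⬝ᵥ ((Aᵀ * S * A) *ᵥ x ω) + 2 * (x ω ⬝ᵥ ((Aᵀ * S * b) *ᵥ u t))
        + u t ⬝ᵥ ((bᵀ * S * b) *ᵥ u t)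
        + 2 * (ξ (t + 1) ω * ((A *ᵥ x ω + b *ᵥ u t) ⬝ᵥ (S *ᵥ (C *ᵥ x ω))))
        + ξ (t + 1) ω ^ 2 * ((C *ᵥ x ω) ⬝ᵥ (S *ᵥ (C *ᵥ x ω))) := by
    intro ω
    have hstate : state A C b ξ a u (t + 1) ω
        = (A *ᵥ x ω + b *ᵥ u t) + ξ (t + 1) ω • (C *ᵥ x ω) := rfl
    rw [hstate, ← mulVec_bilin_mulVec, ← mulVec_bilin_mulVec, ← mulVec_bilin_mulVec]
    generalize A *ᵥ x ω = p
    generalize C *ᵥ x ω = r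
    generalize b *ᵥ u t = w
    generalize ξ (t + 1) ω = z
    simp only [mulVec_add, mulVec_smul, dotProduct_add, add_dotProduct, smul_dotProduct,
      dotProduct_smul, smul_eq_mul]
    rw [bilin_comm hS w p, bilin_comm hS r p, bilin_comm hS r w]
    ring
  have hlin := (integrable_dotProduct_const hx ((Aᵀ * S * b) *ᵥ u t)).const_mul 2
  have h2 : Integrable (fun ω => x ω ⬝ᵥ ((Aᵀ * S * A) *ᵥ x ω)
      + 2 * (x ω ⬝ᵥ ((Aᵀ * S * b) *ᵥ u t))) P := hq.add hlin
  have h3 : Integrable (fun ω => x ω ⬝ᵥ ((Aᵀ * S * A) *ᵥ x ω)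
      + 2 * (x ω ⬝ᵥ ((Aᵀ * S * b) *ᵥ u t)) + u t ⬝ᵥ ((bᵀ * S * b) *ᵥ u t)) P :=
    h2.add (integrable_const _)
  have h4 : Integrable (fun ω => x ω ⬝ᵥ ((Aᵀ * S * A) *ᵥ x ω)
      + 2 * (x ω ⬝ᵥ ((Aᵀ * S * b) *ᵥ u t)) + u t ⬝ᵥ ((bᵀ * S * b) *ᵥ u t)
      + 2 * (ξ (t + 1) ω * ((A *ᵥ x ω + b *ᵥ u t) ⬝ᵥ (S *ᵥ (C *ᵥ x ω))))) P :=
    h3.add (hIr.const_mul 2)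
  unfold quadMean
  simp only [hpoint]
  rw [integral_add h4 hIs, integral_add h3 (hIr.const_mul 2), integral_add h2 (integrable_const _),
    integral_add hq hlin, hEs, integral_const_mul, integral_const_mul, hEr,
    integral_dotProduct_const hx]
  simp only [lyap_apply, add_mulVec, dotProduct_add]
  rw [integral_add hq (integrable_bilin hx hx _)]
  simp
  ring

lemma quadMean_add {x : Ω → Fin n → ℝ} (hx : ∀ i, MemLp (fun ω => x ω i) 2 P)
    (S T : Matrix (Fin n) (Fin n) ℝ) :
    quadMean P x (S + T) = quadMean P x S + quadMean P x T := by
  simp only [quadMean, add_mulVec, dotProduct_add]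
  exact integral_add (integrable_bilin hx hx S) (integrable_bilin hx hx T)

lemma quadMean_mono {x : Ω → Fin n → ℝ} (hx : ∀ i, MemLp (fun ω => x ω i) 2 P)
    {S T : Matrix (Fin n) (Fin n) ℝ} (h : ∀ y, y ⬝ᵥ (S *ᵥ y) ≤ y ⬝ᵥ (T *ᵥ y)) :
    quadMean P x S ≤ quadMean P x T :=
  integral_mono (integrable_bilin hx hx S) (integrable_bilin hx hx T) fun ω => h (x ω)

lemma quadMean_smul {x : Ω → Fin n → ℝ} (r : ℝ) (S : Matrix (Fin n) (Fin n) ℝ) :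
    quadMean P x (r • S) = r * quadMean P x S := by
  simp only [quadMean, smul_mulVec, dotProduct_smul, smul_eq_mul, integral_const_mul]

lemma abs_quadMean_le {x : Ω → Fin n → ℝ} (hx : ∀ i, MemLp (fun ω => x ω i) 2 P)
    {S : Matrix (Fin n) (Fin n) ℝ} {c : ℝ} (h : ∀ y : Fin n → ℝ, |y ⬝ᵥ (S *ᵥ y)| ≤ c * (y ⬝ᵥ y)) :
    |quadMean P x S| ≤ c * quadMean P x 1 := by
  rw [← quadMean_smul, abs_le, ← neg_one_mul, ← quadMean_smul]
  constructor <;> refine quadMean_mono hx fun y => ?_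
  · have := (abs_le.1 (h y)).1
    simpa [smul_mulVec, dotProduct_smul, neg_mulVec] using this
  · have := (abs_le.1 (h y)).2
    simpa [smul_mulVec, dotProduct_smul] using this

lemma mean_dotProduct_self_le [IsProbabilityMeasure P] {x : Ω → Fin n → ℝ}
    (hx : ∀ i, MemLp (fun ω => x ω i) 2 P) : mean P x ⬝ᵥ mean P x ≤ quadMean P x 1 := by
  simp only [quadMean, one_mulVec, dotProduct, mean]
  rw [integral_finsetSum _ fun i _ => by exact (hx i).integrable_mul (hx i)]
  refine Finset.sum_le_sum fun i _ => ?_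
  have h := variance_nonneg (fun ω => x ω i) P
  rw [variance_eq_sub (hx i)] at h
  simp only [Pi.pow_apply, sq] at h
  linarith

end

/-! ### Mean-square stability and the Lyapunov equations -/

lemma mem_admissible_iff {m : ℕ} {u : ℕ → Fin m → ℝ} :
    u ∈ admissible m ↔ Summable fun t => u t ⬝ᵥ u t := by
  simp [admissible, dotProduct, sq]

/-- The trajectory of the noise-free system `x_{t+1} = A x_t + b u_t`. -/
def traj {R : Type*} [CommRing R] {n m : ℕ} (A : Matrix (Fin n) (Fin n) R)
    (b : Matrix (Fin n) (Fin m) R) (x₀ : Fin n → R) (u : ℕ → Fin m → R) : ℕ → Fin n → R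
  | 0 => x₀
  | t + 1 => A *ᵥ traj A b x₀ u t + b *ᵥ u t

section

variable {Ω : Type*} [MeasurableSpace Ω] {P : Measure Ω} [IsProbabilityMeasure P] {n m : ℕ}
  {A C : Matrix (Fin n) (Fin n) ℝ} {b : Matrix (Fin n) (Fin m) ℝ}
  {ξ : ℕ → Ω → ℝ} {a : Ω → Fin n → ℝ} {u : ℕ → Fin m → ℝ}

lemma mean_state_eq_traj (hξ : IsWhiteNoise P ξ) (ha : IsInitialState P ξ a) (t : ℕ) :
    mean P (state A C b ξ a u t) = traj A b (mean P a) u t := by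
  induction t with
  | zero => rfl
  | succ t ih => rw [mean_state_succ hξ ha, ih, traj]

lemma quadMean_uncontrolled (hξ : IsWhiteNoise P ξ) (x₀ : Fin n → ℝ)
    {S : Matrix (Fin n) (Fin n) ℝ} (hS : S.IsSymm) (t : ℕ) :
    quadMean P (state A C (0 : Matrix (Fin n) (Fin 0) ℝ) ξ (fun _ => x₀) 0 t) S =
      x₀ ⬝ᵥ ((lyap A C ^ t) S *ᵥ x₀) := by
  induction t generalizing S with
  | zero => simp [quadMean, state]
  | succ t ih =>
    rw [quadMean_state_succ hξ (isInitialState_const x₀) hS, ih (lyap_isSymm A C hS), pow_succ,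
      Module.End.mul_apply]
    simp

lemma MeanSquareStable.tendsto_quad (hξ : IsWhiteNoise P ξ) (hst : MeanSquareStable P A C ξ)
    {S : Matrix (Fin n) (Fin n) ℝ} (hS : S.IsSymm) (x₀ : Fin n → ℝ) :
    Tendsto (fun t => x₀ ⬝ᵥ ((lyap A C ^ t) S *ᵥ x₀)) atTop (𝓝 0) := by
  obtain ⟨c, -, hc⟩ := exists_abs_quad_le S
  have h1 : Tendsto (fun t => c * quadMean P
      (state A C (0 : Matrix (Fin n) (Fin 0) ℝ) ξ (fun _ => x₀) 0 t) 1) atTop (𝓝 0) := by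
    have := (hst x₀).const_mul c
    rw [mul_zero] at this
    refine this.congr fun t => ?_
    simp [quadMean, dotProduct, sq]
  refine squeeze_zero_norm (fun t => ?_) h1
  rw [← quadMean_uncontrolled hξ x₀ hS, Real.norm_eq_abs]
  exact abs_quadMean_le (memLp_state hξ (isInitialState_const x₀) t) hc

/-- A symmetric fixed point `D` of `S ↦ Aᵀ S A + Cᵀ S C` has `xᵀ D x = E[x_tᵀ D x_t] → 0`. -/
lemma MeanSquareStable.eq_zero_of_lyap_eq (hξ : IsWhiteNoise P ξ)
    (hst : MeanSquareStable P A C ξ) {D : Matrix (Fin n) (Fin n) ℝ} (hD : D.IsSymm)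
    (h : lyap A C D = D) : D = 0 := by
  have hpow : ∀ t, (lyap A C ^ t) D = D := by
    intro t
    induction t with
    | zero => simp
    | succ t ih => rw [pow_succ, Module.End.mul_apply, h, ih]
  have hq : ∀ x, x ⬝ᵥ (D *ᵥ x) = 0 := by
    intro x
    have := hst.tendsto_quad hξ hD x
    simp only [hpow] at this
    exact tendsto_nhds_unique tendsto_const_nhds this
  ext i j
  rw [symm_apply_eq_quad hD, hq, hq, hq]
  simp

/-- The equation is solved on all matrices, with the right-hand side symmetrised: the symmetrised
operator is injective, hence surjective, and its solutions for symmetric `G` are symmetric. -/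
lemma MeanSquareStable.exists_lyap_solution (hξ : IsWhiteNoise P ξ)
    (hst : MeanSquareStable P A C ξ) {G : Matrix (Fin n) (Fin n) ℝ} (hG : G.IsSymm) :
    ∃ H : Matrix (Fin n) (Fin n) ℝ, H.IsSymm ∧ H = lyap A C H + G := by
  let f : Matrix (Fin n) (Fin n) ℝ →ₗ[ℝ] Matrix (Fin n) (Fin n) ℝ :=
    LinearMap.id - lyap A C ∘ₗ ((1 / 2 : ℝ) • (LinearMap.id +
      (transposeLinearEquiv (Fin n) (Fin n) ℝ ℝ).toLinearMap))
  have hf : ∀ S, f S = S - lyap A C ((1 / 2 : ℝ) • (S + Sᵀ)) := fun S => rfl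
  have hsym : ∀ S : Matrix (Fin n) (Fin n) ℝ, ((1 / 2 : ℝ) • (S + Sᵀ)).IsSymm := by
    intro S
    simp [IsSymm, add_comm]
  have hhalf : ∀ S : Matrix (Fin n) (Fin n) ℝ, S.IsSymm → (1 / 2 : ℝ) • (S + Sᵀ) = S := by
    intro S hS
    rw [hS.eq, ← two_smul ℝ S, smul_smul]
    norm_num
  have hsol : ∀ S K : Matrix (Fin n) (Fin n) ℝ, K.IsSymm → f S = K →
      S.IsSymm ∧ S = lyap A C S + K := by
    intro S K hK h
    have h1 : S = lyap A C ((1 / 2 : ℝ) • (S + Sᵀ)) + K := by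
      rw [← h, hf]
      abel
    have hS : S.IsSymm := by
      rw [h1]
      exact (lyap_isSymm A C (hsym S)).add hK
    rw [hhalf S hS] at h1
    exact ⟨hS, h1⟩
  have hinj : Function.Injective f := by
    rw [← LinearMap.ker_eq_bot, LinearMap.ker_eq_bot']
    intro S hS
    obtain ⟨h1, h2⟩ := hsol S 0 (by simp [IsSymm]) hS
    rw [add_zero] at h2
    exact hst.eq_zero_of_lyap_eq hξ h1 h2.symm
  obtain ⟨H, hH⟩ := LinearMap.injective_iff_surjective.1 hinj G
  exact ⟨H, hsol H G hG hH⟩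

lemma MeanSquareStable.exists_pow_le (hξ : IsWhiteNoise P ξ) (hst : MeanSquareStable P A C ξ) :
    ∃ N : ℕ, ∀ x : Fin n → ℝ, x ⬝ᵥ ((lyap A C ^ N) 1 *ᵥ x) ≤ 1 / 2 * (x ⬝ᵥ x) := by
  have hone : (1 : Matrix (Fin n) (Fin n) ℝ).IsSymm := isSymm_one
  have hentry : ∀ i j, Tendsto (fun t => (lyap A C ^ t) 1 i j) atTop (𝓝 0) := by
    intro i j
    have h := fun x => hst.tendsto_quad hξ hone x
    have := ((((h (Pi.single i 1 + Pi.single j 1)).sub (h (Pi.single i 1))).sub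
      (h (Pi.single j 1))).div_const 2)
    simp only [sub_zero, zero_div] at this
    exact this.congr fun t => (symm_apply_eq_quad (lyap_pow_isSymm A C hone t) i j).symm
  set ε : ℝ := 1 / (2 * (n + 1)) with hε
  have hε0 : 0 < ε := by positivity
  have hev : ∀ᶠ t in atTop, ∀ i j, |(lyap A C ^ t) 1 i j| ≤ ε := by
    rw [eventually_all]
    intro i
    rw [eventually_all]
    intro j
    have := (hentry i j).abs
    rw [abs_zero] at this
    exact this.eventually_le_const hε0
  obtain ⟨N, hN⟩ := hev.exists
  refine ⟨N, fun x => ?_⟩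
  generalize (lyap A C ^ N) 1 = S at hN
  have hx := dotProduct_self_nonneg_real x
  calc x ⬝ᵥ (S *ᵥ x) ≤ ∑ i, ∑ j, ε * (x i * x i + x j * x j) / 2 := by
        simp only [dotProduct, mulVec, Finset.mul_sum]
        refine Finset.sum_le_sum fun i _ => Finset.sum_le_sum fun j _ => ?_
        have h1 := abs_le.1 (hN i j)
        nlinarith [mul_nonneg (sub_nonneg.2 h1.2) (sq_nonneg (x i + x j)),
          mul_nonneg (by linarith : 0 ≤ S i j + ε) (sq_nonneg (x i - x j))]
    _ = ε * n * (x ⬝ᵥ x) := by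
        simp only [← Finset.sum_div, ← Finset.mul_sum, Finset.sum_add_distrib, Finset.sum_const,
          Finset.card_univ, Fintype.card_fin, nsmul_eq_mul, dotProduct]
        simp only [mul_left_comm _ (n : ℝ), ← Finset.mul_sum]
        ring
    _ ≤ 1 / 2 * (x ⬝ᵥ x) := by
        refine mul_le_mul_of_nonneg_right ?_ hx
        rw [hε, div_mul_eq_mul_div, one_mul, div_le_div_iff₀ (by positivity) two_pos]
        linarith

/-- A Lyapunov function of the uncontrolled system. A finite partial sum of `∑_t L^t I`, where
`L S = Aᵀ S A + Cᵀ S C`, is enough, so no geometric decay of `L^t` is needed. -/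
lemma MeanSquareStable.exists_lyapunov_function (hξ : IsWhiteNoise P ξ)
    (hst : MeanSquareStable P A C ξ) :
    ∃ K : Matrix (Fin n) (Fin n) ℝ, K.IsSymm ∧ (∀ x, 0 ≤ x ⬝ᵥ (K *ᵥ x)) ∧
      ∀ x, x ⬝ᵥ (lyap A C K *ᵥ x) ≤ x ⬝ᵥ ((K - (1 / 2 : ℝ) • 1) *ᵥ x) := by
  obtain ⟨N, hN⟩ := hst.exists_pow_le hξ
  have hone : (1 : Matrix (Fin n) (Fin n) ℝ).IsSymm := isSymm_one
  refine ⟨∑ t ∈ Finset.range N, (lyap A C ^ t) 1, ?_, fun x => ?_, fun x => ?_⟩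
  · rw [IsSymm, transpose_sum]
    exact Finset.sum_congr rfl fun t _ => lyap_pow_isSymm A C hone t
  · rw [sum_mulVec, dotProduct_sum]
    exact Finset.sum_nonneg fun t _ => quad_lyap_pow_nonneg A C
      (fun y => by simpa using dotProduct_self_nonneg_real y) t x
  · have h : lyap A C (∑ t ∈ Finset.range N, (lyap A C ^ t) 1)
        = ∑ t ∈ Finset.range N, (lyap A C ^ t) 1 + (lyap A C ^ N) 1 - 1 := by
      rw [← Finset.sum_range_succ, Finset.sum_range_succ', map_sum]
      simp [pow_succ', Module.End.mul_apply]
    have h2 := hN x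
    rw [h]
    simp only [sub_mulVec, add_mulVec, dotProduct_sub, dotProduct_add, smul_mulVec, one_mulVec,
      dotProduct_smul, smul_eq_mul]
    linarith

/-- Square-summable controls produce square-summable states. -/
lemma MeanSquareStable.summable_quadMean (hξ : IsWhiteNoise P ξ) (hst : MeanSquareStable P A C ξ)
    (ha : IsInitialState P ξ a) (hu : u ∈ admissible m) :
    Summable fun t => quadMean P (state A C b ξ a u t) 1 := by
  obtain ⟨K, hK, hK0, hKL⟩ := hst.exists_lyapunov_function hξ
  obtain ⟨c, hc, hcK⟩ := exists_abs_bilin_le (Aᵀ * K * b) (ε := 1 / 8) (by norm_num)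
  obtain ⟨d, hd, hdK⟩ := exists_abs_quad_le (bᵀ * K * b)
  have hx := memLp_state (A := A) (C := C) (b := b) (u := u) hξ ha
  rw [mem_admissible_iff] at hu
  have hq0 : ∀ t, 0 ≤ quadMean P (state A C b ξ a u t) 1 := fun t =>
    (dotProduct_self_nonneg_real _).trans (mean_dotProduct_self_le (hx t))
  have hqK : ∀ t, 0 ≤ quadMean P (state A C b ξ a u t) K := fun t =>
    integral_nonneg fun ω => hK0 _
  have hstep : ∀ t, 1 / 4 * quadMean P (state A C b ξ a u t) 1 ≤
      quadMean P (state A C b ξ a u t) K - quadMean P (state A C b ξ a u (t + 1)) K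
        + (2 * c + d) * (u t ⬝ᵥ u t) := by
    intro t
    have h1 := quadMean_mono (hx t) hKL
    rw [sub_eq_add_neg, ← neg_smul, quadMean_add (hx t), quadMean_smul] at h1
    have h2 := quadMean_state_succ (A := A) (C := C) (b := b) (u := u) hξ ha hK t
    have h3 := (abs_le.1 (hcK (mean P (state A C b ξ a u t)) (u t))).2
    have h4 := (abs_le.1 (hdK (u t))).2
    have h5 := mean_dotProduct_self_le (hx t)
    linarith
  refine summable_of_sum_range_le (c := 4 * (quadMean P (state A C b ξ a u 0) K
    + (2 * c + d) * ∑' t, u t ⬝ᵥ u t)) hq0 fun N => ?_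
  have hsum := Finset.sum_le_sum fun t (_ : t ∈ Finset.range N) => hstep t
  rw [← Finset.mul_sum, Finset.sum_add_distrib,
    Finset.sum_range_sub' (fun t => quadMean P (state A C b ξ a u t) K), ← Finset.mul_sum] at hsum
  have h6 := hu.sum_le_tsum (Finset.range N) fun t _ => dotProduct_self_nonneg_real (u t)
  have h7 := mul_le_mul_of_nonneg_left h6 (by positivity : 0 ≤ 2 * c + d)
  have h8 := hqK N
  linarith

/-- The noise-free trajectory is the mean of the stochastic one, and a mean is dominated by the
second moment. -/
lemma MeanSquareStable.summable_traj (hξ : IsWhiteNoise P ξ) (hst : MeanSquareStable P A C ξ)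
    (x₀ : Fin n → ℝ) (hu : u ∈ admissible m) :
    Summable fun t => traj A b x₀ u t ⬝ᵥ traj A b x₀ u t := by
  have ha := isInitialState_const (P := P) (ξ := ξ) x₀
  refine (hst.summable_quadMean hξ ha hu (b := b)).of_nonneg_of_le
    (fun t => dotProduct_self_nonneg_real _) fun t => ?_
  have h := mean_dotProduct_self_le (memLp_state (A := A) (C := C) (b := b) (u := u) hξ ha t)
  rw [mean_state_eq_traj hξ ha] at h
  have hm : mean P (fun _ : Ω => x₀) = x₀ := by
    ext i
    simp [mean]
  rwa [hm] at h

/-! ### Reduction to a deterministic problem -/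

lemma summable_quad {x : ℕ → Fin n → ℝ} (hx : Summable fun t => x t ⬝ᵥ x t)
    (S : Matrix (Fin n) (Fin n) ℝ) : Summable fun t => x t ⬝ᵥ (S *ᵥ x t) := by
  obtain ⟨c, -, hc⟩ := exists_abs_quad_le S
  exact (hx.mul_left c).of_norm_bounded fun t => hc (x t)

lemma summable_bilin {x : ℕ → Fin n → ℝ} {v : ℕ → Fin m → ℝ}
    (hx : Summable fun t => x t ⬝ᵥ x t) (hv : Summable fun t => v t ⬝ᵥ v t)
    (S : Matrix (Fin n) (Fin m) ℝ) : Summable fun t => x t ⬝ᵥ (S *ᵥ v t) := by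
  obtain ⟨c, -, hc⟩ := exists_abs_bilin_le S one_pos
  exact ((hx.mul_left 1).add (hv.mul_left c)).of_norm_bounded fun t => hc (x t) (v t)

lemma summable_stageCost {x : ℕ → Fin n → ℝ} {v : ℕ → Fin m → ℝ}
    (hx : Summable fun t => x t ⬝ᵥ x t) (hv : Summable fun t => v t ⬝ᵥ v t)
    (G : Matrix (Fin n) (Fin n) ℝ) (γ : Matrix (Fin n) (Fin m) ℝ) (Γ : Matrix (Fin m) (Fin m) ℝ) :
    Summable fun t => stageCost G γ Γ (x t) (v t) :=
  ((summable_quad hx G).add ((summable_bilin hx hv γ).mul_left 2)).add (summable_quad hv Γ)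

lemma integrable_stageCost {x : Ω → Fin n → ℝ} (hx : ∀ i, MemLp (fun ω => x ω i) 2 P)
    (G : Matrix (Fin n) (Fin n) ℝ) (γ : Matrix (Fin n) (Fin m) ℝ) (Γ : Matrix (Fin m) (Fin m) ℝ)
    (w : Fin m → ℝ) : Integrable (fun ω => stageCost G γ Γ (x ω) w) P :=
  ((integrable_bilin hx hx G).add ((integrable_dotProduct_const hx (γ *ᵥ w)).const_mul 2)).add
    (integrable_const _)

lemma integral_stageCost {x : Ω → Fin n → ℝ} (hx : ∀ i, MemLp (fun ω => x ω i) 2 P)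
    (G : Matrix (Fin n) (Fin n) ℝ) (γ : Matrix (Fin n) (Fin m) ℝ) (Γ : Matrix (Fin m) (Fin m) ℝ)
    (w : Fin m → ℝ) : ∫ ω, stageCost G γ Γ (x ω) w ∂P =
      quadMean P x G + 2 * (mean P x ⬝ᵥ (γ *ᵥ w)) + w ⬝ᵥ (Γ *ᵥ w) := by
  have h1 := integrable_bilin hx hx G
  have h2 := (integrable_dotProduct_const hx (γ *ᵥ w)).const_mul 2
  have h3 : Integrable (fun ω => x ω ⬝ᵥ (G *ᵥ x ω) + 2 * (x ω ⬝ᵥ (γ *ᵥ w))) P := h1.add h2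
  simp only [stageCost]
  rw [integral_add h3 (integrable_const _), integral_add h1 h2, integral_const_mul,
    integral_dotProduct_const hx]
  simp [quadMean]

lemma MeanSquareStable.summable_integral_stageCost (hξ : IsWhiteNoise P ξ)
    (hst : MeanSquareStable P A C ξ) (ha : IsInitialState P ξ a) (hu : u ∈ admissible m)
    (G : Matrix (Fin n) (Fin n) ℝ) (γ : Matrix (Fin n) (Fin m) ℝ)
    (Γ : Matrix (Fin m) (Fin m) ℝ) :
    Summable fun t => ∫ ω, stageCost G γ Γ (state A C b ξ a u t ω) (u t) ∂P := by
  have hx := memLp_state (A := A) (C := C) (b := b) (u := u) hξ ha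
  obtain ⟨c, -, hc⟩ := exists_abs_quad_le G
  have h1 : Summable fun t => quadMean P (state A C b ξ a u t) G :=
    ((hst.summable_quadMean hξ ha hu).mul_left c).of_norm_bounded fun t =>
      abs_quadMean_le (hx t) hc
  have h2 := hst.summable_traj hξ (mean P a) hu (b := b)
  rw [mem_admissible_iff] at hu
  refine ((h1.add ((summable_bilin h2 hu γ).mul_left 2)).add (summable_quad hu Γ)).congr
    fun t => ?_
  rw [integral_stageCost (hx t), mean_state_eq_traj hξ ha]

/-- The cost of the deterministic problem for the system `x_{t+1} = A x_t + b u_t`. -/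
noncomputable def trajCost (A : Matrix (Fin n) (Fin n) ℝ) (b : Matrix (Fin n) (Fin m) ℝ)
    (Θ : Matrix (Fin n) (Fin n) ℝ) (γ : Matrix (Fin n) (Fin m) ℝ) (Γ : Matrix (Fin m) (Fin m) ℝ)
    (x₀ : Fin n → ℝ) (u : ℕ → Fin m → ℝ) : ℝ :=
  ∑' t, stageCost Θ γ Γ (traj A b x₀ u t) (u t)

/-- Up to a constant that depends on the initial state only, the stochastic cost is the
deterministic cost of the mean trajectory, with `G` replaced by `Θ`. With `m_t = E x_t`, the stage
costs differ by `d_t - d_{t+1}`, where `d_t = E[x_tᵀ H x_t] - m_tᵀ H m_t` tends to zero. -/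
lemma MeanSquareStable.cost_eq (hξ : IsWhiteNoise P ξ) (hst : MeanSquareStable P A C ξ)
    (ha : IsInitialState P ξ a) (hu : u ∈ admissible m) {G H Θ : Matrix (Fin n) (Fin n) ℝ}
    (γ : Matrix (Fin n) (Fin m) ℝ) (Γ : Matrix (Fin m) (Fin m) ℝ) (hH : H.IsSymm)
    (hHG : H = lyap A C H + G) (hΘ : H = Aᵀ * H * A + Θ) :
    cost P A C b G γ Γ ξ a u =
      (quadMean P a H - mean P a ⬝ᵥ (H *ᵥ mean P a)) + trajCost A b Θ γ Γ (mean P a) u := by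
  have hx := memLp_state (A := A) (C := C) (b := b) (u := u) hξ ha
  have hs1 := hst.summable_integral_stageCost hξ ha hu G γ Γ (b := b)
  have hm := hst.summable_traj hξ (mean P a) hu (b := b)
  have hs2 := summable_stageCost hm (mem_admissible_iff.1 hu) Θ γ Γ
  set d : ℕ → ℝ := fun t => quadMean P (state A C b ξ a u t) H
    - traj A b (mean P a) u t ⬝ᵥ (H *ᵥ traj A b (mean P a) u t) with hd
  have hd0 : Tendsto d atTop (𝓝 0) := by
    obtain ⟨c, -, hc⟩ := exists_abs_quad_le H
    have h1 : Summable fun t => quadMean P (state A C b ξ a u t) H :=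
      ((hst.summable_quadMean hξ ha hu).mul_left c).of_norm_bounded fun t =>
        abs_quadMean_le (hx t) hc
    exact (h1.sub (summable_quad hm H)).tendsto_atTop_zero
  have hstep : ∀ t, ∫ ω, stageCost G γ Γ (state A C b ξ a u t ω) (u t) ∂P
      - stageCost Θ γ Γ (traj A b (mean P a) u t) (u t) = d t - d (t + 1) := by
    intro t
    have h1 := quadMean_state_succ (A := A) (C := C) (b := b) (u := u) hξ ha hH t
    have h2 : quadMean P (state A C b ξ a u t) H =
        quadMean P (state A C b ξ a u t) (lyap A C H) + quadMean P (state A C b ξ a u t) G := by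
      rw [← quadMean_add (hx t), ← hHG]
    have h3 : traj A b (mean P a) u t ⬝ᵥ (H *ᵥ traj A b (mean P a) u t) =
        traj A b (mean P a) u t ⬝ᵥ ((Aᵀ * H * A) *ᵥ traj A b (mean P a) u t)
          + traj A b (mean P a) u t ⬝ᵥ (Θ *ᵥ traj A b (mean P a) u t) := by
      rw [← dotProduct_add, ← add_mulVec, ← hΘ]
    have h4 : traj A b (mean P a) u (t + 1) ⬝ᵥ (H *ᵥ traj A b (mean P a) u (t + 1)) =
        traj A b (mean P a) u t ⬝ᵥ ((Aᵀ * H * A) *ᵥ traj A b (mean P a) u t)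
          + 2 * (traj A b (mean P a) u t ⬝ᵥ ((Aᵀ * H * b) *ᵥ u t))
          + u t ⬝ᵥ ((bᵀ * H * b) *ᵥ u t) := by
      simp only [traj, ← mulVec_bilin_mulVec, mulVec_add, dotProduct_add, add_dotProduct]
      rw [bilin_comm hH (b *ᵥ u t) (A *ᵥ _)]
      ring
    rw [integral_stageCost (hx t)]
    simp only [hd, stageCost]
    rw [mean_state_eq_traj hξ ha] at h1 ⊢
    linarith
  have hdiff : HasSum (fun t => ∫ ω, stageCost G γ Γ (state A C b ξ a u t ω) (u t) ∂P
      - stageCost Θ γ Γ (traj A b (mean P a) u t) (u t)) (d 0) := by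
    rw [(hs1.sub hs2).hasSum_iff_tendsto_nat]
    simp only [hstep, Finset.sum_range_sub']
    simpa using hd0.const_sub (d 0)
  have h5 := (hdiff.add hs2.hasSum).tsum_eq
  simp only [sub_add_cancel] at h5
  rw [cost, h5]
  rfl

end

/-! ### Real and imaginary parts -/

/-- The real-linear functionals `φ` to which this is applied are the real and the imaginary
part. -/
lemma comp_toC_mulVec {k l : ℕ} (φ : ℂ →ₗ[ℝ] ℝ) (M : Matrix (Fin k) (Fin l) ℝ) (y : Fin l → ℂ) :
    φ ∘ (toC M *ᵥ y) = M *ᵥ (φ ∘ y) := by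
  ext i
  simp only [Function.comp_apply, mulVec, dotProduct, map_sum]
  refine Finset.sum_congr rfl fun j _ => ?_
  have : toC M i j * y j = M i j • y j := by simp
  rw [this, map_smul, smul_eq_mul]

lemma map_toC_conj_toC {n : ℕ} (φ : ℂ →ₗ[ℝ] ℝ) (M : Matrix (Fin n) (Fin n) ℝ)
    (D : Matrix (Fin n) (Fin n) ℂ) :
    ((toC M)ᵀ * D * toC M).map φ = Mᵀ * D.map φ * M := by
  ext i j
  simp only [map_apply, Matrix.mul_apply, Finset.sum_mul, map_sum, transpose_apply]
  refine Finset.sum_congr rfl fun p _ => Finset.sum_congr rfl fun q _ => ?_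
  have : (M q i : ℂ) * D q p * (M p j : ℂ) = (M q i * M p j) • D q p := by
    simp
    ring
  rw [this, map_smul, smul_eq_mul]
  ring

lemma comp_eq_traj {n m : ℕ} {A : Matrix (Fin n) (Fin n) ℝ} {b : Matrix (Fin n) (Fin m) ℝ}
    (φ : ℂ →ₗ[ℝ] ℝ) {Y : ℕ → Fin n → ℂ} {V : ℕ → Fin m → ℂ}
    (h : ∀ t, Y (t + 1) = toC A *ᵥ Y t + toC b *ᵥ V t) (t : ℕ) :
    φ ∘ Y t = traj A b (φ ∘ Y 0) (fun s => φ ∘ V s) t := by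
  induction t with
  | zero => rfl
  | succ t ih =>
    have hadd : ∀ p q : Fin n → ℂ, φ ∘ (p + q) = φ ∘ p + φ ∘ q := by
      intro p q
      ext i
      simp
    rw [traj, ← ih, h, hadd, comp_toC_mulVec, comp_toC_mulVec]

lemma re_bilin_toC {k l : ℕ} (M : Matrix (Fin k) (Fin l) ℝ) (x : Fin k → ℂ) (y : Fin l → ℂ) :
    (star x ⬝ᵥ (toC M *ᵥ y)).re =
      (Complex.reLm ∘ x) ⬝ᵥ (M *ᵥ (Complex.reLm ∘ y))
        + (Complex.imLm ∘ x) ⬝ᵥ (M *ᵥ (Complex.imLm ∘ y)) := by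
  rw [← comp_toC_mulVec, ← comp_toC_mulVec]
  simp [dotProduct, Finset.sum_add_distrib]

lemma hermForm_toC {n m : ℕ} (Θ : Matrix (Fin n) (Fin n) ℝ) (γ : Matrix (Fin n) (Fin m) ℝ)
    (Γ : Matrix (Fin m) (Fin m) ℝ) (x : Fin n → ℂ) (u : Fin m → ℂ) :
    hermForm (toC Θ) γ Γ x u =
      stageCost Θ γ Γ (Complex.reLm ∘ x) (Complex.reLm ∘ u)
        + stageCost Θ γ Γ (Complex.imLm ∘ x) (Complex.imLm ∘ u) := by
  simp only [hermForm, stageCost, re_bilin_toC]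
  ring

lemma lyapunovPair_toC {n : ℕ} {A C G H Θ : Matrix (Fin n) (Fin n) ℝ} (hG : G.IsSymm)
    (hH : H.IsSymm) (hHG : H = lyap A C H + G) (hΘ : H = Aᵀ * H * A + Θ) :
    LyapunovPair A C G (toC H) (toC Θ) := by
  have hT : Θ = Cᵀ * H * C + G := by
    have h := hHG.symm.trans hΘ
    rw [lyap_apply, add_assoc] at h
    exact (add_left_cancel h).symm
  have hTs : Θ.IsSymm := by
    rw [hT]
    simp only [IsSymm, transpose_add, transpose_mul, transpose_transpose, hH.eq, hG.eq,
      Matrix.mul_assoc]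
  have hmap : ∀ M N : Matrix (Fin n) (Fin n) ℝ, (toC M)ᵀ * toC N * toC M = toC (Mᵀ * N * M) := by
    intro M N
    have hmul : ∀ M N : Matrix (Fin n) (Fin n) ℝ, toC (M * N) = toC M * toC N := fun M N =>
      Matrix.map_mul (f := Complex.ofRealHom)
    rw [hmul, hmul]
    rfl
  refine ⟨?_, ?_, ?_, ?_⟩
  · rw [IsSymm, ← transpose_map, hH.eq]
  · rw [IsSymm, ← transpose_map, hTs.eq]
  · rw [hmap]
    ext i j
    have := congrFun (congrFun hΘ i) j
    simp only [Matrix.add_apply, Matrix.sub_apply, map_apply, Matrix.zero_apply] at this ⊢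
    rw [this]
    push_cast
    ring
  · rw [hmap]
    ext i j
    have := congrFun (congrFun hT i) j
    simp only [Matrix.add_apply, Matrix.sub_apply, map_apply, Matrix.zero_apply] at this ⊢
    rw [this]
    push_cast
    ring

/-- The real and the imaginary part of the difference of two solutions are symmetric fixed points
of `S ↦ Aᵀ S A + Cᵀ S C`. -/
lemma MeanSquareStable.lyapunovPair_unique {Ω : Type*} [MeasurableSpace Ω] {P : Measure Ω}
    [IsProbabilityMeasure P] {ξ : ℕ → Ω → ℝ} (hξ : IsWhiteNoise P ξ) {n : ℕ}
    {A C G : Matrix (Fin n) (Fin n) ℝ} (hst : MeanSquareStable P A C ξ)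
    {H₁ Θ₁ H₂ Θ₂ : Matrix (Fin n) (Fin n) ℂ} (h₁ : LyapunovPair A C G H₁ Θ₁)
    (h₂ : LyapunovPair A C G H₂ Θ₂) : H₁ = H₂ ∧ Θ₁ = Θ₂ := by
  obtain ⟨hs₁, -, ha₁, hb₁⟩ := h₁
  obtain ⟨hs₂, -, ha₂, hb₂⟩ := h₂
  have hD : (toC A)ᵀ * (H₁ - H₂) * toC A + (toC C)ᵀ * (H₁ - H₂) * toC C = H₁ - H₂ := by
    rw [sub_eq_zero, sub_eq_iff_eq_add] at hb₁ hb₂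
    rw [hb₁] at ha₁
    rw [hb₂] at ha₂
    simp only [Matrix.mul_sub, Matrix.sub_mul]
    rw [← sub_eq_zero] at ha₁ ha₂ ⊢
    have := congrArg₂ (· - ·) ha₁ ha₂
    simp only [sub_zero] at this
    rw [← this]
    abel
  have hzero : ∀ φ : ℂ →ₗ[ℝ] ℝ, (H₁ - H₂).map φ = 0 := by
    intro φ
    refine hst.eq_zero_of_lyap_eq hξ ?_ ?_
    · rw [IsSymm, ← transpose_map, (hs₁.sub hs₂).eq]
    · rw [lyap_apply, ← map_toC_conj_toC, ← map_toC_conj_toC, ← Matrix.map_add _ (map_add φ), hD]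
  have hH : H₁ = H₂ := by
    rw [← sub_eq_zero]
    ext i j
    exact Complex.ext (congrFun (congrFun (hzero Complex.reLm) i) j)
      (congrFun (congrFun (hzero Complex.imLm) i) j)
  subst hH
  refine ⟨rfl, ?_⟩
  rw [sub_eq_zero, sub_eq_iff_eq_add] at hb₁ hb₂
  rw [hb₁, hb₂]

/-! ### The deterministic problem -/

section

variable {n m : ℕ} {A : Matrix (Fin n) (Fin n) ℝ} {b : Matrix (Fin n) (Fin m) ℝ}
  {Θ H : Matrix (Fin n) (Fin n) ℝ} {γ : Matrix (Fin n) (Fin m) ℝ} {Γ : Matrix (Fin m) (Fin m) ℝ}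

/-- Square-summable controls produce square-summable trajectories. -/
def IsL2Stable (A : Matrix (Fin n) (Fin n) ℝ) (b : Matrix (Fin n) (Fin m) ℝ) : Prop :=
  ∀ (x₀ : Fin n → ℝ), ∀ u ∈ admissible m, Summable fun t => traj A b x₀ u t ⬝ᵥ traj A b x₀ u t

lemma traj_add_smul (x₀ : Fin n → ℝ) (u v : ℕ → Fin m → ℝ) (r : ℝ) (t : ℕ) :
    traj A b x₀ (u + r • v) t = traj A b x₀ u t + r • traj A b 0 v t := by
  induction t with
  | zero => simp [traj]
  | succ t ih =>
    simp only [traj, ih, Pi.add_apply, Pi.smul_apply, mulVec_add, mulVec_smul, smul_add]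
    abel

lemma add_smul_mem_admissible {u v : ℕ → Fin m → ℝ} (hu : u ∈ admissible m)
    (hv : v ∈ admissible m) (r : ℝ) : u + r • v ∈ admissible m := by
  rw [mem_admissible_iff] at hu hv ⊢
  refine ((hu.add ((summable_bilin hu hv 1).mul_left (2 * r))).add
    (hv.mul_left (r ^ 2))).congr fun t => ?_
  simp only [Pi.add_apply, Pi.smul_apply, dotProduct_add, add_dotProduct, smul_dotProduct,
    dotProduct_smul, smul_eq_mul, one_mulVec]
  rw [dotProduct_comm (v t) (u t)]
  ring

/-- Along a line in the space of controls the deterministic cost is a quadratic polynomial. -/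
lemma exists_trajCost_add_smul (hA : IsL2Stable A b) (Θ : Matrix (Fin n) (Fin n) ℝ)
    (γ : Matrix (Fin n) (Fin m) ℝ) (Γ : Matrix (Fin m) (Fin m) ℝ) (x₀ : Fin n → ℝ)
    {u v : ℕ → Fin m → ℝ} (hu : u ∈ admissible m) (hv : v ∈ admissible m) :
    ∃ B : ℝ, ∀ r : ℝ, trajCost A b Θ γ Γ x₀ (u + r • v) =
      trajCost A b Θ γ Γ x₀ u + r * B + r ^ 2 * trajCost A b Θ γ Γ 0 v := by
  have hx := hA x₀ u hu
  have hy := hA 0 v hv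
  rw [mem_admissible_iff] at hu hv
  set x := traj A b x₀ u
  set y := traj A b 0 v
  have hsu := summable_stageCost hx hu Θ γ Γ
  have hsv := summable_stageCost hy hv Θ γ Γ
  have hsB : Summable fun t => x t ⬝ᵥ (Θ *ᵥ y t) + y t ⬝ᵥ (Θ *ᵥ x t)
      + 2 * (x t ⬝ᵥ (γ *ᵥ v t)) + 2 * (y t ⬝ᵥ (γ *ᵥ u t))
      + u t ⬝ᵥ (Γ *ᵥ v t) + v t ⬝ᵥ (Γ *ᵥ u t) :=
    (((((summable_bilin hx hy Θ).add (summable_bilin hy hx Θ)).add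
      ((summable_bilin hx hv γ).mul_left 2)).add ((summable_bilin hy hu γ).mul_left 2)).add
      (summable_bilin hu hv Γ)).add (summable_bilin hv hu Γ)
  obtain ⟨B, hB⟩ := hsB
  refine ⟨B, fun r => ?_⟩
  have h := (hsu.hasSum.add (hB.mul_left r)).add (hsv.hasSum.mul_left (r ^ 2))
  refine Eq.trans (tsum_congr fun t => ?_) h.tsum_eq
  rw [traj_add_smul]
  simp only [stageCost, Pi.add_apply, Pi.smul_apply, mulVec_add, mulVec_smul, dotProduct_add,
    add_dotProduct, smul_dotProduct, dotProduct_smul, smul_eq_mul]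
  ring

/-- The control that agrees with `v` before time `T` and vanishes afterwards. -/
def truncate (T : ℕ) (v : ℕ → Fin m → ℝ) : ℕ → Fin m → ℝ :=
  fun t => if t < T then v t else 0

lemma truncate_mem_admissible (T : ℕ) (v : ℕ → Fin m → ℝ) : truncate T v ∈ admissible m := by
  refine summable_of_ne_finset_zero (s := Finset.range T) fun t ht => ?_
  simp [truncate, Finset.mem_range.not.1 ht]

lemma traj_truncate (x₀ : Fin n → ℝ) (v : ℕ → Fin m → ℝ) {T t : ℕ} (ht : t ≤ T) :
    traj A b x₀ (truncate T v) t = traj A b x₀ v t := by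
  induction t with
  | zero => rfl
  | succ t ih => rw [traj, traj, ih (by omega), truncate, if_pos (by omega)]

/-- Once the control has been switched off, the remaining cost telescopes to `y_Tᵀ H y_T`. -/
lemma trajCost_truncate (hA : IsL2Stable A b) (hΘ : H = Aᵀ * H * A + Θ) (v : ℕ → Fin m → ℝ)
    (T : ℕ) : trajCost A b Θ γ Γ 0 (truncate T v) =
      ∑ t ∈ Finset.range T, stageCost Θ γ Γ (traj A b 0 v t) (v t)
        + traj A b 0 v T ⬝ᵥ (H *ᵥ traj A b 0 v T) := by
  have hw := truncate_mem_admissible T v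
  have hy := hA 0 _ hw
  have hs := summable_stageCost hy (mem_admissible_iff.1 hw) Θ γ Γ
  rw [trajCost, ← hs.sum_add_tsum_nat_add T]
  congr 1
  · refine Finset.sum_congr rfl fun t ht => ?_
    have := Finset.mem_range.1 ht
    rw [traj_truncate _ _ this.le, truncate, if_pos this]
  · set y := traj A b 0 (truncate T v) with hydef
    have hstep : ∀ t, stageCost Θ γ Γ (y (t + T)) (truncate T v (t + T)) =
        y (t + T) ⬝ᵥ (H *ᵥ y (t + T)) - y (t + 1 + T) ⬝ᵥ (H *ᵥ y (t + 1 + T)) := by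
      intro t
      have h0 : truncate T v (t + T) = 0 := if_neg (by omega)
      have h1 : y (t + 1 + T) = A *ᵥ y (t + T) := by
        rw [add_right_comm, hydef, traj, h0, mulVec_zero, add_zero]
      have h2 : y (t + T) ⬝ᵥ (H *ᵥ y (t + T)) = y (t + T) ⬝ᵥ ((Aᵀ * H * A) *ᵥ y (t + T))
          + y (t + T) ⬝ᵥ (Θ *ᵥ y (t + T)) := by
        rw [← dotProduct_add, ← add_mulVec, ← hΘ]
      rw [h0, h1, mulVec_bilin_mulVec, h2]
      simp [stageCost]
    have hlim := (summable_nat_add_iff T).2 (summable_quad hy H) |>.tendsto_atTop_zero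
    refine HasSum.tsum_eq ?_
    rw [((summable_nat_add_iff T).2 hs).hasSum_iff_tendsto_nat]
    simp only [hstep, Finset.sum_range_sub' (fun t => y (t + T) ⬝ᵥ (H *ᵥ y (t + T)))]
    rw [← traj_truncate 0 v le_rfl]
    simpa using hlim.const_sub (y (0 + T) ⬝ᵥ (H *ᵥ y (0 + T)))

lemma tendsto_traj_zero (hA : IsL2Stable A b) {x₀ : Fin n → ℝ} {u : ℕ → Fin m → ℝ}
    (hu : u ∈ admissible m) (i : Fin n) :
    Tendsto (fun t => traj A b x₀ u t i) atTop (𝓝 0) := by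
  have h := (hA x₀ u hu).tendsto_atTop_zero
  have h2 : Tendsto (fun t => traj A b x₀ u t i ^ 2) atTop (𝓝 0) := by
    refine squeeze_zero (fun t => sq_nonneg _) (fun t => ?_) h
    rw [sq]
    exact Finset.single_le_sum (f := fun i => traj A b x₀ u t i * traj A b x₀ u t i)
      (fun i _ => mul_self_nonneg _) (Finset.mem_univ i)
  rw [tendsto_zero_iff_abs_tendsto_zero]
  have h3 := h2.sqrt
  simpa [Function.comp_def, Real.sqrt_sq_eq_abs] using h3

lemma tendsto_pow_mulVec (hA : IsL2Stable A b) (x : Fin n → ℂ) :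
    Tendsto (fun t => toC A ^ t *ᵥ x) atTop (𝓝 0) := by
  rw [tendsto_pi_nhds]
  intro i
  have hrec : ∀ t, toC A ^ (t + 1) *ᵥ x = toC A *ᵥ (toC A ^ t *ᵥ x)
      + toC b *ᵥ (fun _ => (0 : Fin m → ℂ)) t := by
    intro t
    rw [mulVec_zero, add_zero, mulVec_mulVec, ← pow_succ']
  have hpart : ∀ φ : ℂ →ₗ[ℝ] ℝ, Tendsto (fun t => φ ((toC A ^ t *ᵥ x) i)) atTop (𝓝 0) := by
    intro φ
    have hu : (fun _ : ℕ => φ ∘ (0 : Fin m → ℂ)) ∈ admissible m := by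
      simp [admissible, summable_zero]
    have := tendsto_traj_zero hA (x₀ := φ ∘ (toC A ^ 0 *ᵥ x)) hu i
    refine this.congr fun t => ?_
    exact (congrFun (comp_eq_traj (Y := fun t => toC A ^ t *ᵥ x) φ hrec t) i).symm
  have h1 := (Complex.continuous_ofReal.tendsto 0).comp (hpart Complex.reLm)
  have h2 := ((Complex.continuous_ofReal.tendsto 0).comp (hpart Complex.imLm)).mul_const Complex.I
  have h3 := h1.add h2
  simp only [Complex.ofReal_zero, zero_mul, add_zero] at h3
  exact h3.congr fun t => Complex.re_add_im _

end

section

variable {n m : ℕ} {A : Matrix (Fin n) (Fin n) ℝ} {b : Matrix (Fin n) (Fin m) ℝ}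
  {Θ H : Matrix (Fin n) (Fin n) ℝ} {γ : Matrix (Fin n) (Fin m) ℝ} {Γ : Matrix (Fin m) (Fin m) ℝ}

/-! ### The resolvent on the unit circle -/

lemma isUnit_det_sub (hA : spectralRadius ℂ (toC A) < 1) {z : ℂ} (hz : ‖z‖ = 1) :
    IsUnit (z • (1 : Matrix (Fin n) (Fin n) ℂ) - toC A).det := by
  have h : z ∈ resolventSet ℂ (toC A) := by
    refine spectrum.mem_resolventSet_of_spectralRadius_lt (hA.trans_eq ?_)
    rw [← enorm_eq_nnnorm, ← ofReal_norm, hz, ENNReal.ofReal_one]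
  rw [← isUnit_iff_isUnit_det, ← Algebra.algebraMap_eq_smul_one]
  exact h

lemma resolventMatrix_mulVec_eq_iff (hA : spectralRadius ℂ (toC A) < 1) {z : ℂ} (hz : ‖z‖ = 1)
    (x w : Fin n → ℂ) : x = resolventMatrix A z *ᵥ w ↔ z • x - toC A *ᵥ x = w := by
  have hu := isUnit_det_sub hA hz
  have h : z • x - toC A *ᵥ x = (z • (1 : Matrix (Fin n) (Fin n) ℂ) - toC A) *ᵥ x := by
    rw [sub_mulVec, smul_mulVec, one_mulVec]
  rw [h, resolventMatrix]
  constructor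
  · rintro rfl
    rw [mulVec_mulVec, mul_nonsing_inv _ hu, one_mulVec]
  · rintro rfl
    rw [mulVec_mulVec, nonsing_inv_mul _ hu, one_mulVec]

lemma exists_resolventMatrix_bound (hA : spectralRadius ℂ (toC A) < 1) :
    ∃ K : ℝ, 0 ≤ K ∧ ∀ z : ℂ, ‖z‖ = 1 → ∀ w : Fin n → ℂ,
      ∑ i, ‖(resolventMatrix A z *ᵥ w) i‖ ^ 2 ≤ K * ∑ i, ‖w i‖ ^ 2 := by
  have hcont : ContinuousOn (fun z : ℂ => ∑ i, ∑ j, ‖resolventMatrix A z i j‖ ^ 2)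
      (Metric.sphere 0 1) := by
    have hlin : Continuous fun z : ℂ => z • (1 : Matrix (Fin n) (Fin n) ℂ) - toC A := by fun_prop
    have hinv : ContinuousOn
        (fun z : ℂ => (z • (1 : Matrix (Fin n) (Fin n) ℂ) - toC A).det⁻¹) (Metric.sphere 0 1) :=
      hlin.matrix_det.continuousOn.inv₀ fun z hz =>
        (isUnit_det_sub hA (by simpa using hz)).ne_zero
    refine continuousOn_finsetSum _ fun i _ => continuousOn_finsetSum _ fun j _ => ?_
    simp only [resolventMatrix, inv_def, Ring.inverse_eq_inv', Matrix.smul_apply]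
    have hadj := (hlin.matrix_adjugate.matrix_elem i j).continuousOn (s := Metric.sphere (0 : ℂ) 1)
    exact ((hinv.smul hadj).norm).pow 2
  obtain ⟨K, hK⟩ := (isCompact_sphere (0 : ℂ) 1).exists_bound_of_continuousOn hcont
  refine ⟨max K 0, le_max_right _ _, fun z hz w => ?_⟩
  refine (sum_norm_mulVec_sq_le _ w).trans (mul_le_mul_of_nonneg_right ?_ (by positivity))
  exact (le_abs_self _).trans ((hK z (by simpa using hz)).trans (le_max_left _ _))

/-! ### The frequency inequality -/

lemma hermForm_smul (Θ : Matrix (Fin n) (Fin n) ℂ) (γ : Matrix (Fin n) (Fin m) ℝ)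
    (Γ : Matrix (Fin m) (Fin m) ℝ) {c : ℂ} (hc : ‖c‖ = 1) (x : Fin n → ℂ) (u : Fin m → ℂ) :
    hermForm Θ γ Γ (c • x) (c • u) = hermForm Θ γ Γ x u := by
  have hcc : c * star c = 1 := by
    rw [Complex.star_def, Complex.mul_conj', hc]
    simp
  simp only [hermForm, star_smul, mulVec_smul, smul_dotProduct, dotProduct_smul, smul_smul, hcc,
    one_smul]

/-- If the deterministic cost from the zero state is nonnegative, then so is the cost of every
complex trajectory from the zero state, stopped at time `T`. -/
lemma sum_hermForm_nonneg (hA : IsL2Stable A b) (hΘ : H = Aᵀ * H * A + Θ)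
    (hQ : ∀ v ∈ admissible m, 0 ≤ trajCost A b Θ γ Γ 0 v) {Y : ℕ → Fin n → ℂ}
    {V : ℕ → Fin m → ℂ} (hY0 : Y 0 = 0) (hY : ∀ t, Y (t + 1) = toC A *ᵥ Y t + toC b *ᵥ V t)
    (T : ℕ) :
    0 ≤ ∑ t ∈ Finset.range T, hermForm (toC Θ) γ Γ (Y t) (V t)
      + (star (Y T) ⬝ᵥ (toC H *ᵥ Y T)).re := by
  have hpart : ∀ φ : ℂ →ₗ[ℝ] ℝ,
      0 ≤ ∑ t ∈ Finset.range T, stageCost Θ γ Γ (φ ∘ Y t) (φ ∘ V t)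
        + (φ ∘ Y T) ⬝ᵥ (H *ᵥ (φ ∘ Y T)) := by
    intro φ
    have h := hQ _ (truncate_mem_admissible T fun t => φ ∘ V t)
    rw [trajCost_truncate hA hΘ] at h
    have h0 : φ ∘ Y 0 = 0 := by
      ext i
      simp [hY0]
    have ht : ∀ t, φ ∘ Y t = traj A b 0 (fun s => φ ∘ V s) t := fun t => by
      rw [comp_eq_traj φ hY t, h0]
    simpa only [← ht] using h
  have h1 := hpart Complex.reLm
  have h2 := hpart Complex.imLm
  rw [re_bilin_toC]
  simp only [hermForm_toC, Finset.sum_add_distrib]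
  linarith

/-- The frequency inequality: the control `z^t w` on a long time window produces
`z^t (x - z^{-t} A^t x)` with `x = g(z) b w`, so that the cost per unit time tends to the value of
the form at `(x, w)`. -/
theorem hermForm_resolvent_nonneg (hρ : spectralRadius ℂ (toC A) < 1) (hA : IsL2Stable A b)
    (hΘ : H = Aᵀ * H * A + Θ) (hQ : ∀ v ∈ admissible m, 0 ≤ trajCost A b Θ γ Γ 0 v) {z : ℂ}
    (hz : ‖z‖ = 1) (w : Fin m → ℂ) :
    0 ≤ hermForm (toC Θ) γ Γ (resolventMatrix A z *ᵥ (toC b *ᵥ w)) w := by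
  obtain ⟨x, hx⟩ : ∃ x, x = resolventMatrix A z *ᵥ (toC b *ᵥ w) := ⟨_, rfl⟩
  rw [← hx]
  rw [resolventMatrix_mulVec_eq_iff hρ hz] at hx
  have hz0 : z ≠ 0 := by
    rintro rfl
    simp at hz
  have hzt : ∀ t : ℕ, ‖z ^ t‖ = 1 := fun t => by rw [norm_pow, hz, one_pow]
  set e : ℕ → Fin n → ℂ := fun t => (z⁻¹) ^ t • (toC A ^ t *ᵥ x) with he
  have hze : ∀ t, z ^ t • e t = toC A ^ t *ᵥ x := by
    intro t
    rw [he]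
    simp only
    rw [smul_smul, ← mul_pow, mul_inv_cancel₀ hz0, one_pow, one_smul]
  have he0 : Tendsto e atTop (𝓝 0) := by
    have h := tendsto_pow_mulVec hA x
    rw [tendsto_pi_nhds] at h ⊢
    intro i
    refine squeeze_zero_norm (fun t => le_of_eq ?_) (by simpa using (h i).norm)
    simp [he, hz]
  have hYV := sum_hermForm_nonneg (γ := γ) (Γ := Γ) hA hΘ hQ (Y := fun t => z ^ t • (x - e t))
    (V := fun t => z ^ t • w) (by simp [he]) (fun t => by
      rw [smul_sub, hze, smul_sub, hze, mulVec_sub, mulVec_smul, mulVec_smul, mulVec_mulVec,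
        ← pow_succ', ← hx, pow_succ z, mul_smul, smul_sub]
      abel)
  have hquad : ∀ y : Fin n → ℂ, (star y ⬝ᵥ (toC H *ᵥ y)).re
      = hermForm (toC H) (0 : Matrix (Fin n) (Fin 0) ℝ) 0 y 0 := by
    intro y
    simp [hermForm]
  have hquad_smul : ∀ (c : ℂ) (y : Fin n → ℂ), ‖c‖ = 1 →
      (star (c • y) ⬝ᵥ (toC H *ᵥ (c • y))).re = (star y ⬝ᵥ (toC H *ᵥ y)).re := by
    intro c y hc
    rw [hquad, hquad, ← hermForm_smul (toC H) _ _ hc y 0, smul_zero]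
  simp only [hermForm_smul _ _ _ (hzt _), hquad_smul _ _ (hzt _)] at hYV
  have hf : Tendsto (fun t => hermForm (toC Θ) γ Γ (x - e t) w) atTop
      (𝓝 (hermForm (toC Θ) γ Γ x w)) := by
    have hc : Continuous fun y : Fin n → ℂ => hermForm (toC Θ) γ Γ (x - y) w := by
      unfold hermForm
      fun_prop
    simpa [Function.comp_def] using (hc.tendsto 0).comp he0
  have hh : Tendsto (fun t => (star (x - e t) ⬝ᵥ (toC H *ᵥ (x - e t))).re) atTop
      (𝓝 (star x ⬝ᵥ (toC H *ᵥ x)).re) := by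
    have hc : Continuous fun y : Fin n → ℂ => (star (x - y) ⬝ᵥ (toC H *ᵥ (x - y))).re := by
      fun_prop
    simpa [Function.comp_def] using (hc.tendsto 0).comp he0
  have hlim := hf.cesaro.add ((tendsto_inv_atTop_nhds_zero_nat (𝕜 := ℝ)).mul hh)
  rw [zero_mul, add_zero] at hlim
  refine ge_of_tendsto' hlim fun T => ?_
  rw [← mul_add]
  exact mul_nonneg (by positivity) (hYV T)

/-! ### Coercivity from the strict frequency inequality -/

/-- The Fourier sum `∑_{t < N} z^{-t} x_t`. -/
noncomputable def fourierSum {k : ℕ} (x : ℕ → Fin k → ℂ) (N : ℕ) (z : ℂ) : Fin k → ℂ :=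
  ∑ t ∈ Finset.range N, (z⁻¹) ^ t • x t

lemma sum_rootsOfUnity_pow_mul {N : ℕ} {ζ : ℂ} (hζ : IsPrimitiveRoot ζ N) {s t : ℕ}
    (hs : s < N) (ht : t < N) :
    ∑ k ∈ Finset.range N, (ζ ^ k) ^ s * ((ζ ^ k)⁻¹) ^ t = if s = t then (N : ℂ) else 0 := by
  have hζ0 : ζ ≠ 0 := hζ.ne_zero (by omega)
  have hterm : ∀ k, (ζ ^ k) ^ s * ((ζ ^ k)⁻¹) ^ t = (ζ ^ s * (ζ ^ t)⁻¹) ^ k := by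
    intro k
    rw [mul_pow, inv_pow, inv_pow, ← pow_mul, ← pow_mul, ← pow_mul, ← pow_mul, mul_comm k s,
      mul_comm k t]
  simp only [hterm]
  split_ifs with h
  · subst h
    simp [mul_inv_cancel₀ (pow_ne_zero s hζ0)]
  · set q := ζ ^ s * (ζ ^ t)⁻¹
    have hq : q - 1 ≠ 0 := by
      intro h1
      refine h (hζ.pow_inj hs ht ?_)
      rw [sub_eq_zero] at h1
      exact (mul_inv_eq_one₀ (pow_ne_zero t hζ0)).1 h1
    have hqN : q ^ N = 1 := by
      rw [mul_pow, inv_pow, ← pow_mul, ← pow_mul, mul_comm s, mul_comm t, pow_mul, pow_mul,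
        hζ.pow_eq_one]
      simp
    have := geom_sum_mul q N
    rw [hqN, sub_self] at this
    exact (mul_eq_zero.1 this).resolve_right hq

/-- Parseval's identity for the discrete Fourier transform and a sesquilinear form. -/
lemma sum_bilin_fourierSum {k l N : ℕ} {ζ : ℂ} (hζ : IsPrimitiveRoot ζ N) (hN : N ≠ 0)
    (M : Matrix (Fin k) (Fin l) ℂ) (x : ℕ → Fin k → ℂ) (u : ℕ → Fin l → ℂ) :
    ∑ j ∈ Finset.range N,
        star (fourierSum x N (ζ ^ j)) ⬝ᵥ (M *ᵥ fourierSum u N (ζ ^ j)) =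
      N * ∑ t ∈ Finset.range N, star (x t) ⬝ᵥ (M *ᵥ u t) := by
  have hstar : ∀ j, star ((ζ ^ j)⁻¹) = ζ ^ j := by
    intro j
    have hn : ‖(ζ ^ j)⁻¹‖ = 1 := by
      rw [norm_inv, norm_pow, hζ.norm'_eq_one hN, one_pow, inv_one]
    rw [Complex.star_def, ← Complex.inv_eq_conj hn, inv_inv]
  have hexp : ∀ j, star (fourierSum x N (ζ ^ j)) ⬝ᵥ (M *ᵥ fourierSum u N (ζ ^ j)) =
      ∑ s ∈ Finset.range N, ∑ t ∈ Finset.range N,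
        (ζ ^ j) ^ s * ((ζ ^ j)⁻¹) ^ t * (star (x s) ⬝ᵥ (M *ᵥ u t)) := by
    intro j
    simp only [fourierSum, star_sum, star_smul, star_pow, hstar, mulVec_sum, mulVec_smul,
      sum_dotProduct, dotProduct_sum, smul_dotProduct, dotProduct_smul, smul_eq_mul,
      Finset.mul_sum]
    rw [Finset.sum_comm]
    refine Finset.sum_congr rfl fun s _ => Finset.sum_congr rfl fun t _ => ?_
    ring
  simp only [hexp]
  rw [Finset.sum_comm, Finset.mul_sum]
  refine Finset.sum_congr rfl fun s hs => ?_
  rw [Finset.sum_comm]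
  have hs' := Finset.mem_range.1 hs
  calc ∑ t ∈ Finset.range N, ∑ j ∈ Finset.range N,
        (ζ ^ j) ^ s * ((ζ ^ j)⁻¹) ^ t * (star (x s) ⬝ᵥ (M *ᵥ u t))
      = ∑ t ∈ Finset.range N, (if s = t then (N : ℂ) else 0) * (star (x s) ⬝ᵥ (M *ᵥ u t)) := by
        refine Finset.sum_congr rfl fun t ht => ?_
        rw [← Finset.sum_mul, sum_rootsOfUnity_pow_mul hζ hs' (Finset.mem_range.1 ht)]
    _ = _ := by simp [ite_mul, hs']

lemma sum_hermForm_fourierSum {N : ℕ} {ζ : ℂ} (hζ : IsPrimitiveRoot ζ N) (hN : N ≠ 0)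
    (Θ : Matrix (Fin n) (Fin n) ℂ) (γ : Matrix (Fin n) (Fin m) ℝ) (Γ : Matrix (Fin m) (Fin m) ℝ)
    (x : ℕ → Fin n → ℂ) (u : ℕ → Fin m → ℂ) :
    ∑ j ∈ Finset.range N, hermForm Θ γ Γ (fourierSum x N (ζ ^ j)) (fourierSum u N (ζ ^ j)) =
      N * ∑ t ∈ Finset.range N, hermForm Θ γ Γ (x t) (u t) := by
  have h := fun {k l : ℕ} (M : Matrix (Fin k) (Fin l) ℂ) x u =>
    congrArg Complex.re (sum_bilin_fourierSum hζ hN M x u)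
  simp only [Complex.re_sum, Complex.mul_re, Complex.natCast_re, Complex.natCast_im, zero_mul,
    sub_zero] at h
  simp only [hermForm, Finset.sum_add_distrib, ← Finset.mul_sum, h]
  ring

lemma sum_norm_fourierSum {k N : ℕ} {ζ : ℂ} (hζ : IsPrimitiveRoot ζ N) (hN : N ≠ 0)
    (u : ℕ → Fin k → ℂ) :
    ∑ j ∈ Finset.range N, ∑ i, ‖fourierSum u N (ζ ^ j) i‖ ^ 2 =
      N * ∑ t ∈ Finset.range N, ∑ i, ‖u t i‖ ^ 2 := by
  have hnorm : ∀ w : Fin k → ℂ, ((∑ i, ‖w i‖ ^ 2 : ℝ) : ℂ) = star w ⬝ᵥ (1 *ᵥ w) := by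
    intro w
    rw [one_mulVec]
    simp [dotProduct, Complex.conj_mul']
  have h := sum_bilin_fourierSum hζ hN 1 u u
  simp only [← hnorm] at h
  exact_mod_cast h

/-- The transform of a trajectory from the zero state solves the resolvent equation, up to an
error that comes from the final state only. -/
lemma fourierSum_traj {Y : ℕ → Fin n → ℂ} {V : ℕ → Fin m → ℂ} (hY0 : Y 0 = 0)
    (hY : ∀ t, Y (t + 1) = toC A *ᵥ Y t + toC b *ᵥ V t) {z : ℂ} (hz : z ≠ 0) (N : ℕ) :
    z • fourierSum Y N z - toC A *ᵥ fourierSum Y N z =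
      toC b *ᵥ fourierSum V N z - (z * (z⁻¹) ^ N) • Y N := by
  induction N with
  | zero => simp [fourierSum, hY0]
  | succ N ih =>
    have hs : ∀ {k : ℕ} (x : ℕ → Fin k → ℂ), fourierSum x (N + 1) z
        = fourierSum x N z + (z⁻¹) ^ N • x N := fun x => Finset.sum_range_succ _ _
    have hz1 : z * (z⁻¹) ^ (N + 1) = (z⁻¹) ^ N := by
      rw [pow_succ', ← mul_assoc, mul_inv_cancel₀ hz, one_mul]
    rw [hs, hs, hz1, hY N, smul_add, mulVec_add, mulVec_add, mulVec_smul, mulVec_smul, smul_smul,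
      add_sub_add_comm, ih, smul_add]
    abel

/-- Perturbing the state by `e` lowers the form by a small multiple of `|u|²` and a large multiple
of `|e|²`. -/
lemma exists_hermForm_sub_ge (Θ : Matrix (Fin n) (Fin n) ℂ) (γ : Matrix (Fin n) (Fin m) ℝ)
    (Γ : Matrix (Fin m) (Fin m) ℝ) {K η : ℝ} (hK : 0 ≤ K) (hη : 0 < η) :
    ∃ c : ℝ, 0 ≤ c ∧ ∀ (x e : Fin n → ℂ) (u : Fin m → ℂ),
      ∑ i, ‖x i‖ ^ 2 ≤ K * ∑ i, ‖u i‖ ^ 2 →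
      hermForm Θ γ Γ x u - η * ∑ i, ‖u i‖ ^ 2 - c * ∑ i, ‖e i‖ ^ 2 ≤
        hermForm Θ γ Γ (x - e) u := by
  set ε : ℝ := η / (4 * (K + 1)) with hε
  have hε0 : 0 < ε := by positivity
  -- Young's inequality with the small weight on the second argument
  have young : ∀ {k l : ℕ} (M : Matrix (Fin k) (Fin l) ℂ) {ε : ℝ}, 0 < ε → ∃ c : ℝ, 0 ≤ c ∧
      ∀ (e : Fin k → ℂ) (u : Fin l → ℂ),
        ‖star e ⬝ᵥ (M *ᵥ u)‖ ≤ ε * ∑ i, ‖u i‖ ^ 2 + c * ∑ i, ‖e i‖ ^ 2 := by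
    intro k l M ε hε
    obtain ⟨c, hc, h⟩ := exists_norm_bilin_le Mᴴ hε
    refine ⟨c, hc, fun e u => ?_⟩
    have : star e ⬝ᵥ (M *ᵥ u) = star (star u ⬝ᵥ (Mᴴ *ᵥ e)) := by
      rw [star_dotProduct e, star_mulVec, ← dotProduct_mulVec]
    rw [this, norm_star]
    exact h u e
  obtain ⟨c₁, hc₁, h₁⟩ := exists_norm_bilin_le Θ hε0
  obtain ⟨c₂, hc₂, h₂⟩ := young Θ hε0
  obtain ⟨c₃, hc₃, h₃⟩ := exists_norm_bilin_le Θ one_pos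
  obtain ⟨c₄, hc₄, h₄⟩ := young (toC γ) (by positivity : 0 < η / 4)
  refine ⟨c₁ + c₂ + (1 + c₃) + 2 * c₄, by positivity, fun x e u hx => ?_⟩
  have k₁ := (abs_le.1 ((Complex.abs_re_le_norm _).trans (h₁ x e))).2
  have k₂ := (abs_le.1 ((Complex.abs_re_le_norm _).trans (h₂ e x))).2
  have k₃ := (abs_le.1 ((Complex.abs_re_le_norm _).trans (h₃ e e))).1
  have k₄ := (abs_le.1 ((Complex.abs_re_le_norm _).trans (h₄ e u))).2
  have hu0 : 0 ≤ ∑ i, ‖u i‖ ^ 2 := by positivity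
  have hεK : ε * ∑ i, ‖x i‖ ^ 2 ≤ η / 4 * ∑ i, ‖u i‖ ^ 2 := by
    calc ε * ∑ i, ‖x i‖ ^ 2 ≤ ε * (K * ∑ i, ‖u i‖ ^ 2) := mul_le_mul_of_nonneg_left hx hε0.le
      _ = ε * K * ∑ i, ‖u i‖ ^ 2 := by ring
      _ ≤ η / 4 * ∑ i, ‖u i‖ ^ 2 := by
        refine mul_le_mul_of_nonneg_right ?_ hu0
        rw [hε, div_mul_eq_mul_div, div_le_div_iff₀ (by positivity) (by positivity)]
        nlinarith
  simp only [hermForm, star_sub, sub_dotProduct, mulVec_sub, dotProduct_sub, Complex.sub_re]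
  linarith

/-- The strict frequency inequality makes the deterministic cost from the zero state coercive:
Parseval's identity for the `N`-th roots of unity bounds the cost up to time `N` from below, with
an error controlled by `|y_N|²`, and `N` tends to infinity. -/
theorem trajCost_coercive (hρ : spectralRadius ℂ (toC A) < 1) (hA : IsL2Stable A b) {δ : ℝ}
    (hδ : 0 < δ) (hfreq : ∀ z : ℂ, ‖z‖ = 1 → ∀ u : Fin m → ℂ, δ * ∑ i, ‖u i‖ ^ 2 ≤
      hermForm (toC Θ) γ Γ (resolventMatrix A z *ᵥ (toC b *ᵥ u)) u)
    {v : ℕ → Fin m → ℝ} (hv : v ∈ admissible m) :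
    δ / 2 * ∑' t, v t ⬝ᵥ v t ≤ trajCost A b Θ γ Γ 0 v := by
  obtain ⟨K, hK, hKg⟩ := exists_resolventMatrix_bound hρ
  set Kb : ℝ := ∑ i, ∑ j, ‖toC b i j‖ ^ 2 with hKb
  have hKb0 : 0 ≤ Kb := by positivity
  obtain ⟨c, hc, hpert⟩ := exists_hermForm_sub_ge (toC Θ) γ Γ (K := K * Kb) (η := δ / 2)
    (by positivity) (by positivity)
  set y := traj A b 0 v with hy
  set Y : ℕ → Fin n → ℂ := fun t i => (y t i : ℂ) with hYdef
  set V : ℕ → Fin m → ℂ := fun t i => (v t i : ℂ) with hVdef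
  have hY0 : Y 0 = 0 := by
    ext i
    simp [hYdef, hy, traj]
  have hY : ∀ t, Y (t + 1) = toC A *ᵥ Y t + toC b *ᵥ V t := by
    intro t
    ext i
    simp [hYdef, hVdef, hy, traj, mulVec, dotProduct]
  have hreal : ∀ t, hermForm (toC Θ) γ Γ (Y t) (V t) = stageCost Θ γ Γ (y t) (v t) := by
    intro t
    have h1 : Complex.reLm ∘ Y t = y t := rfl
    have h2 : Complex.reLm ∘ V t = v t := rfl
    have h3 : Complex.imLm ∘ Y t = 0 := rfl
    have h4 : Complex.imLm ∘ V t = 0 := rfl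
    rw [hermForm_toC, h1, h2, h3, h4]
    simp [stageCost]
  have hnorm : ∀ {k : ℕ} (w : Fin k → ℝ), ∑ i, ‖(w i : ℂ)‖ ^ 2 = w ⬝ᵥ w := by
    intro k w
    simp [dotProduct, sq]
  have hbound : ∀ N : ℕ, N ≠ 0 →
      δ / 2 * ∑ t ∈ Finset.range N, v t ⬝ᵥ v t - c * K * (y N ⬝ᵥ y N) ≤
        ∑ t ∈ Finset.range N, stageCost Θ γ Γ (y t) (v t) := by
    intro N hN
    have hζ := Complex.isPrimitiveRoot_exp N hN
    set ζ := Complex.exp (2 * Real.pi * Complex.I / N)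
    have hpoint : ∀ j, δ / 2 * ∑ i, ‖fourierSum V N (ζ ^ j) i‖ ^ 2 - c * K * (y N ⬝ᵥ y N) ≤
        hermForm (toC Θ) γ Γ (fourierSum Y N (ζ ^ j)) (fourierSum V N (ζ ^ j)) := by
      intro j
      have hz : ‖ζ ^ j‖ = 1 := by rw [norm_pow, hζ.norm'_eq_one hN, one_pow]
      have hz0 : ζ ^ j ≠ 0 := by
        rw [← norm_ne_zero_iff, hz]
        exact one_ne_zero
      generalize ζ ^ j = z at hz hz0
      set û := fourierSum V N z
      have h1 := (resolventMatrix_mulVec_eq_iff hρ hz _ _).2 (fourierSum_traj hY0 hY hz0 N)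
      rw [mulVec_sub] at h1
      rw [h1]
      have h2 : ∑ i, ‖(resolventMatrix A z *ᵥ (toC b *ᵥ û)) i‖ ^ 2 ≤
          K * Kb * ∑ i, ‖û i‖ ^ 2 := by
        refine (hKg z hz _).trans ?_
        rw [mul_assoc]
        exact mul_le_mul_of_nonneg_left (sum_norm_mulVec_sq_le _ _) hK
      have h3 := hKg z hz ((z * (z⁻¹) ^ N) • Y N)
      have h4 : ∑ i, ‖((z * (z⁻¹) ^ N) • Y N) i‖ ^ 2 = y N ⬝ᵥ y N := by
        rw [← hnorm]
        refine Finset.sum_congr rfl fun i _ => ?_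
        simp [hYdef, hz]
      rw [h4] at h3
      have h5 := hpert _ (resolventMatrix A z *ᵥ ((z * (z⁻¹) ^ N) • Y N)) û h2
      have h6 := hfreq z hz û
      have h7 := mul_le_mul_of_nonneg_left h3 hc
      linarith
    have hsum := Finset.sum_le_sum fun j (_ : j ∈ Finset.range N) => hpoint j
    rw [sum_hermForm_fourierSum hζ hN, Finset.sum_sub_distrib, ← Finset.mul_sum,
      sum_norm_fourierSum hζ hN] at hsum
    simp only [hreal, Finset.sum_const, Finset.card_range, nsmul_eq_mul] at hsum
    simp only [hVdef, hnorm] at hsum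
    have hN0 : (0 : ℝ) < N := by positivity
    refine le_of_mul_le_mul_left ?_ hN0
    linarith
  have hyS := hA 0 v hv
  have hvS := mem_admissible_iff.1 hv
  have hlim1 := (hvS.hasSum.tendsto_sum_nat.const_mul (δ / 2)).sub
    (hyS.tendsto_atTop_zero.const_mul (c * K))
  rw [mul_zero, sub_zero] at hlim1
  have hlim2 := (summable_stageCost hyS hvS Θ γ Γ).hasSum.tendsto_sum_nat
  exact le_of_tendsto_of_tendsto hlim1 hlim2
    ((eventually_ne_atTop 0).mono fun N hN => hbound N hN)

end

/-! ### Optimal controls -/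

lemma trajCost_nonneg_of_minimal {n m : ℕ} {A : Matrix (Fin n) (Fin n) ℝ} {b : Matrix (Fin n) (Fin m) ℝ}
    {Θ : Matrix (Fin n) (Fin n) ℝ} {γ : Matrix (Fin n) (Fin m) ℝ} {Γ : Matrix (Fin m) (Fin m) ℝ}
    (hA : IsL2Stable A b) {x₀ : Fin n → ℝ} {u : ℕ → Fin m → ℝ} (hu : u ∈ admissible m)
    (hmin : ∀ v ∈ admissible m, trajCost A b Θ γ Γ x₀ u ≤ trajCost A b Θ γ Γ x₀ v) :
    ∀ v ∈ admissible m, 0 ≤ trajCost A b Θ γ Γ 0 v := by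
  intro v hv
  obtain ⟨B, hB⟩ := exists_trajCost_add_smul hA Θ γ Γ x₀ hu hv
  have h1 := hmin _ (add_smul_mem_admissible hu hv 1)
  have h2 := hmin _ (add_smul_mem_admissible hu hv (-1))
  rw [hB] at h1 h2
  linarith

/-- If the deterministic cost from the zero state vanishes only at zero, minimizers are unique: at
the midpoint of two minimizers the cost drops by a quarter of the cost of their difference. -/
lemma eq_of_minimal {n m : ℕ} {A : Matrix (Fin n) (Fin n) ℝ} {b : Matrix (Fin n) (Fin m) ℝ}
    {Θ : Matrix (Fin n) (Fin n) ℝ} {γ : Matrix (Fin n) (Fin m) ℝ} {Γ : Matrix (Fin m) (Fin m) ℝ}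
    (hA : IsL2Stable A b) {δ : ℝ} (hδ : 0 < δ)
    (hcoer : ∀ v ∈ admissible m, δ * ∑' t, v t ⬝ᵥ v t ≤ trajCost A b Θ γ Γ 0 v)
    {x₀ : Fin n → ℝ} {u₀ u₁ : ℕ → Fin m → ℝ} (hu₀ : u₀ ∈ admissible m) (hu₁ : u₁ ∈ admissible m)
    (h₀ : ∀ v ∈ admissible m, trajCost A b Θ γ Γ x₀ u₀ ≤ trajCost A b Θ γ Γ x₀ v)
    (h₁ : ∀ v ∈ admissible m, trajCost A b Θ γ Γ x₀ u₁ ≤ trajCost A b Θ γ Γ x₀ v) :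
    u₁ = u₀ := by
  have hv : u₁ + (-1 : ℝ) • u₀ ∈ admissible m := add_smul_mem_admissible hu₁ hu₀ (-1)
  set v := u₁ + (-1 : ℝ) • u₀ with hvdef
  obtain ⟨B, hB⟩ := exists_trajCost_add_smul hA Θ γ Γ x₀ hu₀ hv
  have hv1 : u₀ + (1 : ℝ) • v = u₁ := by
    rw [hvdef]
    simp
  have k1 := hB 1
  rw [hv1] at k1
  have k2 := h₀ _ (add_smul_mem_admissible hu₀ hv (1 / 2))
  rw [hB] at k2
  have k3 := h₁ u₀ hu₀
  have k4 := hcoer v hv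
  have hs := mem_admissible_iff.1 hv
  have hnn : ∀ t, 0 ≤ v t ⬝ᵥ v t := fun t => dotProduct_self_nonneg_real _
  have hsum : ∑' t, v t ⬝ᵥ v t ≤ 0 := by
    by_contra! h
    have := mul_pos hδ h
    linarith
  have hv0 : ∀ t, v t = 0 := fun t => by
    have h := (hs.le_tsum t fun s _ => hnn s).trans hsum
    exact dotProduct_self_eq_zero.1 (le_antisymm h (hnn t))
  rw [← hv1]
  ext t i
  simp [hv0 t]

end LQ

theorem theorem1 {Ω : Type*} [mΩ : MeasurableSpace Ω] (P : Measure Ω) [IsProbabilityMeasure P]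
    {n m : ℕ} (A C : Matrix (Fin n) (Fin n) ℝ) (b : Matrix (Fin n) (Fin m) ℝ)
    (G : Matrix (Fin n) (Fin n) ℝ) (γ : Matrix (Fin n) (Fin m) ℝ) (Γ : Matrix (Fin m) (Fin m) ℝ)
    (hG : G.IsSymm) (hΓ : Γ.IsSymm)
    -- the white noise, adapted to a filtration
    (ℱ : Filtration ℕ mΩ) (ξ : ℕ → Ω → ℝ)
    (hξ_adapted : ∀ t, Measurable[ℱ t] (ξ t))
    (hξ_indep : iIndepFun ξ P)
    (hξ_mean : ∀ t, ∫ ω, ξ t ω ∂P = 0)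
    (hξ_var : ∀ t, variance (ξ t) P = 1)
    -- the random initial state
    (a : Ω → Fin n → ℝ)
    (ha_meas : Measurable[ℱ 0] a)
    (ha_indep : IndepFun a (fun ω t => ξ t ω) P)
    (ha_sq : Integrable (fun ω => ∑ i, (a ω i) ^ 2) P)
    -- stability
    (hA : spectralRadius ℂ (LQ.toC A) < 1)
    (hstab : LQ.MeanSquareStable P A C ξ) :
    -- the functional is well defined on the admissible controls
    (∀ u ∈ LQ.admissible m,
      (∀ t, Integrable (fun ω => LQ.stageCost G γ Γ (LQ.state A C b ξ a u t ω) (u t)) P) ∧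
      Summable fun t => ∫ ω, LQ.stageCost G γ Γ (LQ.state A C b ξ a u t ω) (u t) ∂P) ∧
    -- the Lyapunov equations have exactly one solution
    (∃! p : Matrix (Fin n) (Fin n) ℂ × Matrix (Fin n) (Fin n) ℂ,
      LQ.LyapunovPair A C G p.1 p.2) ∧
    -- the frequency inequality, and uniqueness when it is strict
    ∀ H Θ : Matrix (Fin n) (Fin n) ℂ, LQ.LyapunovPair A C G H Θ →
      ∀ u₀ : ℕ → Fin m → ℝ, LQ.IsOptimal P A C b G γ Γ ξ a u₀ →
        (∀ z : ℂ, ‖z‖ = 1 → ∀ u : Fin m → ℂ,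
          0 ≤ LQ.hermForm Θ γ Γ (LQ.resolventMatrix A z *ᵥ (LQ.toC b *ᵥ u)) u) ∧
        ((∃ δ : ℝ, 0 < δ ∧ ∀ z : ℂ, ‖z‖ = 1 → ∀ u : Fin m → ℂ,
          δ * ∑ i, ‖u i‖ ^ 2 ≤
            LQ.hermForm Θ γ Γ (LQ.resolventMatrix A z *ᵥ (LQ.toC b *ᵥ u)) u) →
          ∀ u₁ : ℕ → Fin m → ℝ, LQ.IsOptimal P A C b G γ Γ ξ a u₁ → u₁ = u₀) := by

  have hξ : LQ.IsWhiteNoise P ξ :=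
    ⟨fun t => (hξ_adapted t).mono (ℱ.le t) le_rfl, hξ_indep, hξ_mean, hξ_var⟩
  have hameas : Measurable a := ha_meas.mono (ℱ.le 0) le_rfl
  have ha : LQ.IsInitialState P ξ a := by
    refine ⟨hameas, ha_indep, fun i => ?_⟩
    have hai : Measurable fun ω => a ω i := (measurable_pi_apply i).comp hameas
    rw [memLp_two_iff_integrable_sq hai.aestronglyMeasurable]
    refine ha_sq.mono' (hai.pow_const 2).aestronglyMeasurable (ae_of_all _ fun ω => ?_)
    rw [Real.norm_eq_abs, abs_of_nonneg (sq_nonneg _)]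
    exact Finset.single_le_sum (f := fun i => a ω i ^ 2) (fun j _ => sq_nonneg _)
      (Finset.mem_univ i)
  obtain ⟨K, hK, hKG⟩ := hstab.exists_lyap_solution hξ hG
  have hKΘ : K = Aᵀ * K * A + (K - Aᵀ * K * A) := by abel
  have hpair := LQ.lyapunovPair_toC hG hK hKG hKΘ
  have hL2 : LQ.IsL2Stable A b := fun x₀ u hu => hstab.summable_traj hξ x₀ hu
  refine ⟨fun u hu => ⟨fun t => LQ.integrable_stageCost (LQ.memLp_state hξ ha t) G γ Γ (u t),
    hstab.summable_integral_stageCost hξ ha hu G γ Γ⟩, ⟨(_, _), hpair, fun p hp => ?_⟩, ?_⟩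
  · obtain ⟨h1, h2⟩ := hstab.lyapunovPair_unique hξ hp hpair
    exact Prod.ext h1 h2
  · intro H Θ hHΘ u₀ hu₀
    obtain ⟨rfl, rfl⟩ := hstab.lyapunovPair_unique hξ hHΘ hpair
    have hmin : ∀ u, LQ.IsOptimal P A C b G γ Γ ξ a u → ∀ v ∈ LQ.admissible m,
        LQ.trajCost A b (K - Aᵀ * K * A) γ Γ (LQ.mean P a) u ≤
          LQ.trajCost A b (K - Aᵀ * K * A) γ Γ (LQ.mean P a) v := by
      intro u hu v hv
      have h := hu.2 v hv
      rw [hstab.cost_eq hξ ha hu.1 γ Γ hK hKG hKΘ, hstab.cost_eq hξ ha hv γ Γ hK hKG hKΘ] at h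
      linarith
    have hQ := LQ.trajCost_nonneg_of_minimal hL2 hu₀.1 (hmin u₀ hu₀)
    refine ⟨fun z hz u => LQ.hermForm_resolvent_nonneg hA hL2 hKΘ hQ hz u, ?_⟩
    rintro ⟨δ, hδ, hfreq⟩ u₁ hu₁
    exact LQ.eq_of_minimal hL2 (half_pos hδ)
      (fun v hv => LQ.trajCost_coercive hA hL2 hδ hfreq hv) hu₀.1 hu₁.1 (hmin u₀ hu₀) (hmin u₁ hu₁)
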